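/- Let $\alpha,\beta,\gamma\in[0,1]$ with $\alpha\ge\gamma$, and let $\mathbf P$ be the symmetric $2\times 2$ matrix with rows and columns labelled by $0,1$ and entries $\mathbf P[1,1]=\alpha$, $\mathbf P[0,1]=\mathbf P[1,0]=\beta$, $\mathbf P[0,0]=\gamma$. The Kronecker graph $\mathcal K(n,\mathbf P)$ is the random simple graph with vertex set $\{0,1\}^n$ in which each pair of distinct vertices $u=(u_1,\dots,u_n)$, $v=(v_1,\dots,v_n)$ is adjacent with probability $p_{u,v}=\prod_{i=1}^n\mathbf P[u_i,v_i]$, independently for each pair. Suppose that either $\beta+\gamma>1$, or $\beta=1$, $\alpha>0$ and $\gamma=0$. Then there exists a constant $a=a(\alpha,\beta,\gamma)$ such that $$\lim_{n\to\infty}\mathbb P\bigl(\operatorname{diam}(\mathcal K(n,\mathbf P))\le a\bigr)=1,$$ where the diameter of a disconnected graph is $\infty$. -/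

import Mathlib

open MeasureTheory Filter Topology

/-- The vertex set `{0,1}^n`. -/
abbrev KVertex (n : ℕ) : Type := Fin n → Fin 2

/-- The symmetric initiator matrix, indexed by labels: the entry at `(1,1)` is `α`, the entries at
`(0,1)` and `(1,0)` are `β`, and the entry at `(0,0)` is `γ`. -/
def initiator (α β γ : unitInterval) : Matrix (Fin 2) (Fin 2) unitInterval :=
  !![γ, β; β, α]

theorem initiator_symm (α β γ : unitInterval) (a b : Fin 2) :
    initiator α β γ a b = initiator α β γ b a := by
  fin_cases a <;> fin_cases b <;> rfl

/-- The probability `p_{u,v} = ∏ i, P[u_i, v_i]` that `u` and `v` are adjacent, as a function of the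
unordered pair `s(u, v)`. -/
noncomputable def edgeProb (n : ℕ) (α β γ : unitInterval) : Sym2 (KVertex n) → unitInterval :=
  Sym2.lift ⟨fun u v => ∏ i, initiator α β γ (u i) (v i), fun u v =>
    Finset.prod_congr rfl fun i _ => initiator_symm α β γ (u i) (v i)⟩

/-- The law of the family of edge indicators: independent coordinates, one for every unordered pair
of vertices, the one of `s(u, v)` being `true` with probability `p_{u,v}`. -/
noncomputable def kroneckerMeasure (n : ℕ) (α β γ : unitInterval) :
    Measure (Sym2 (KVertex n) → Bool) :=
  Measure.pi fun e => ProbabilityTheory.bernoulliMeasure true false (edgeProb n α β γ e)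

/-- The Kronecker graph as a random variable on the space of edge indicators: distinct vertices
`u`, `v` are adjacent iff the indicator of `s(u, v)` is `true` (the indicators of the degenerate
pairs `s(u, u)` play no role, as a simple graph has no loops). -/
def kroneckerGraph (n : ℕ) (ω : Sym2 (KVertex n) → Bool) : SimpleGraph (KVertex n) :=
  SimpleGraph.fromEdgeSet {e | ω e = true}

/-! If `β + γ > 1`, then `β, γ > 0`, and lower bounds on edge probabilities let `γ` play the role of
`α`. The initiator is then compared with the symmetric matrix with rows `(γ, β)`, `(β, γ)`, whose
powers have all entries close to `s ^ k / 2`, where `s = γ + β > 1`. Fix a walk length `ℓ`. The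
first `m = √n` coordinates of a vertex are reserved as a label, and the remaining `N` carry a walk
for the `N`-fold tensor power `Q` of this matrix. Assigning a different label to each intermediate
time makes all possible steps use different edges, hence independent ones; the label costs only a
factor `θ = κ ^ m`, with `κ = min γ β`, which is subexponential in `n`.

A second moment estimate (`le_measureReal_walkWeight_ne_zero`, `le_measureReal_tensorWalk`) gives an
open walk of length `ℓ` between given endpoints with probability at least `1 / (1 + 2 ^ ℓ)`,
uniformly in `n`. There is room for `C * n` edge-disjoint families of labels, so all of them fail
with probability exponentially small at any prescribed rate, which beats the `4 ^ n` pairs of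
vertices.

If `β = 1` and `γ = 0`, read vertices as subsets of `Fin n`: the edge probability is `α ^ |S ∩ T|`
if `S ∪ T` is everything. Every `S` is joined to its complement, and from there, with failure
probability `exp (-2 ^ k)`, to some `S ∪ A` with `|A| = k`. With `k` proportional to `n`, boundedly
many such climbs and a final two-step connection reach the full set. Since `exp (-2 ^ k)` is doubly
exponentially small, a union bound over all subsets suffices. -/

section BernoulliProduct

/-! ### Independence and moments for Bernoulli products. -/

open ProbabilityTheory

variable {E : Type*} [Fintype E]

/-- The product of Bernoulli measures on `E → Bool`, the coordinate `e` being `true` with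
probability `q e`. -/
noncomputable abbrev bernoulliPi (q : E → unitInterval) : Measure (E → Bool) :=
  Measure.pi fun e => bernoulliMeasure true false (q e)

variable (q : E → unitInterval)

theorem indepFun_of_dependsOn {β γ : Type*} [MeasurableSpace β] [MeasurableSpace γ]
    [Nonempty β] [Nonempty γ] {f : (E → Bool) → β} {g : (E → Bool) → γ} {S T : Set E}
    (hST : Disjoint S T) (hf : DependsOn f S) (hg : DependsOn g T) :
    IndepFun f g (bernoulliPi q) := by
  classical
  have hi : iIndepFun (fun (i : E) (ω : E → Bool) => ω i) (bernoulliPi q) :=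
    iIndepFun_pi (X := fun _ b => b) fun _ => aemeasurable_id
  have h := hi.indepFun_finset S.toFinset T.toFinset (by simpa using hST)
    (fun i => measurable_pi_apply i)
  obtain ⟨F, rfl⟩ := (dependsOn_iff_exists_comp (s := (S.toFinset : Set E))).1 (by simpa using hf)
  obtain ⟨G, rfl⟩ := (dependsOn_iff_exists_comp (s := (T.toFinset : Set E))).1 (by simpa using hg)
  exact h.comp (φ := F) (ψ := G) .of_discrete .of_discrete

theorem integral_mul_of_dependsOn {f g : (E → Bool) → ℝ} {S T : Set E}
    (hST : Disjoint S T) (hf : DependsOn f S) (hg : DependsOn g T) :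
    ∫ ω, f ω * g ω ∂bernoulliPi q = (∫ ω, f ω ∂bernoulliPi q) * ∫ ω, g ω ∂bernoulliPi q :=
  (indepFun_of_dependsOn q hST hf hg).integral_fun_mul_eq_mul_integral
    Measurable.of_discrete.aestronglyMeasurable Measurable.of_discrete.aestronglyMeasurable

theorem measureReal_inter_of_dependsOn {A B : Set (E → Bool)} {S T : Set E}
    (hST : Disjoint S T) (hA : DependsOn (fun ω => ω ∈ A) S) (hB : DependsOn (fun ω => ω ∈ B) T) :
    (bernoulliPi q).real (A ∩ B) = (bernoulliPi q).real A * (bernoulliPi q).real B := by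
  have h := (indepFun_of_dependsOn q hST hA hB).measure_inter_preimage_eq_mul {True} {True}
    (by trivial) (by trivial)
  have e : ∀ C : Set (E → Bool), (fun ω => ω ∈ C) ⁻¹' {True} = C := fun C => by
    ext ω; simp
  rw [e, e] at h
  simp only [Measure.real, h, ENNReal.toReal_mul]

theorem measureReal_iInter_of_dependsOn {R : Type*} (s : Finset R) (A : R → Set (E → Bool))
    (S : R → Set E) (hS : Set.PairwiseDisjoint (s : Set R) S)
    (hA : ∀ r ∈ s, DependsOn (fun ω => ω ∈ A r) (S r)) :
    (bernoulliPi q).real {ω | ∀ r ∈ s, ω ∈ A r} = ∏ r ∈ s, (bernoulliPi q).real (A r) := by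
  classical
  induction s using Finset.induction_on with
  | empty => simp
  | insert a s ha ih =>
    have e : {ω | ∀ r ∈ insert a s, ω ∈ A r} = A a ∩ {ω | ∀ r ∈ s, ω ∈ A r} := by
      ext ω; simp
    rw [e, Finset.prod_insert ha, ← ih (hS.subset (by simp))
      fun r hr => hA r (Finset.mem_insert_of_mem hr)]
    refine measureReal_inter_of_dependsOn q (T := ⋃ r ∈ s, S r) ?_
      (hA a (Finset.mem_insert_self a s)) ?_
    · rw [Set.disjoint_iUnion₂_right]
      intro r hr
      exact hS (by simp) (by simp [hr]) (by rintro rfl; exact ha hr)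
    · intro x y hxy
      simp only [Set.mem_ofPred_eq, eq_iff_iff]
      refine forall₂_congr fun r hr => ?_
      exact Iff.of_eq (hA r (Finset.mem_insert_of_mem hr) fun i hi =>
        hxy i (Set.mem_biUnion hr hi))

theorem measureReal_iInter_le_pow {R : Type*} (s : Finset R) (A : R → Set (E → Bool))
    (S : R → Set E) (hS : Set.PairwiseDisjoint (s : Set R) S)
    (hA : ∀ r ∈ s, DependsOn (fun ω => ω ∈ A r) (S r)) {c : ℝ}
    (hc : ∀ r ∈ s, (bernoulliPi q).real (A r) ≤ c) :
    (bernoulliPi q).real {ω | ∀ r ∈ s, ω ∈ A r} ≤ c ^ s.card := by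
  rw [measureReal_iInter_of_dependsOn q s A S hS hA]
  rw [← Finset.prod_const]
  exact Finset.prod_le_prod (fun r _ => measureReal_nonneg) hc

theorem measureReal_coord_true (e : E) :
    (bernoulliPi q).real {ω | ω e = true} = q e := by
  have h := (measurePreserving_eval (fun e => bernoulliMeasure true false (q e)) e).measure_preimage
    (s := {true}) (MeasurableSet.singleton _).nullMeasurableSet
  have h2 : (Function.eval e ⁻¹' {true} : Set (E → Bool)) = {ω | ω e = true} := by
    ext; simp
  rw [h2] at h
  rw [Measure.real, h, ← Measure.real, bernoulliMeasure_real_apply_of_mem_of_notMem] <;> simp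

theorem measureReal_forall_true (s : Finset E) :
    (bernoulliPi q).real {ω | ∀ e ∈ s, ω e = true} = ∏ e ∈ s, (q e : ℝ) := by
  have h := measureReal_iInter_of_dependsOn q s (fun e => {ω | ω e = true}) (fun e => {e})
    (fun a _ b _ hab => by simpa using hab)
    (fun e _ x y hxy => by simp [hxy e rfl])
  simpa [measureReal_coord_true] using h

/-- If pairwise disjoint sets of coordinates are each entirely `true` with probability at least
`c`, then the probability that none is entirely `true` is at most `exp (-c * number)`. -/
theorem measureReal_forall_exists_false_le {R : Type*} (s : Finset R) (S : R → Finset E)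
    (hS : Set.PairwiseDisjoint (s : Set R) S) {c : ℝ} (hc : ∀ r ∈ s, c ≤ ∏ e ∈ S r, (q e : ℝ)) :
    (bernoulliPi q).real {ω | ∀ r ∈ s, ¬ ∀ e ∈ S r, ω e = true} ≤ Real.exp (-(c * s.card)) := by
  have h := measureReal_iInter_le_pow q s (fun r => {ω | ¬ ∀ e ∈ S r, ω e = true})
    (fun r => (S r : Set E)) (fun a ha b hb hab => by
      simpa [Function.onFun] using hS ha hb hab)
    (fun r _ x y hxy => by
      simp only [Set.mem_ofPred_eq, eq_iff_iff]
      exact not_congr (forall₂_congr fun e he => by rw [hxy e he]))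
    (c := Real.exp (-c)) (fun r hr => by
      have := probReal_compl_eq_one_sub (μ := bernoulliPi q)
        (s := {ω | ∀ e ∈ S r, ω e = true}) .of_discrete
      rw [measureReal_forall_true] at this
      change (bernoulliPi q).real {ω | ∀ e ∈ S r, ω e = true}ᶜ ≤ _
      rw [this]
      have h1 := hc r hr
      have h2 := Real.add_one_le_exp (-c)
      linarith)
  refine h.trans_eq ?_
  rw [← Real.exp_nat_mul]
  ring_nf

/-- The indicator that the coordinate `e` is `true`. -/
def coordInd (e : E) (ω : E → Bool) : ℝ := if ω e = true then 1 else 0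

theorem integral_coordInd (e : E) : ∫ ω, coordInd e ω ∂bernoulliPi q = q e := by
  have h : coordInd e = Set.indicator {ω : E → Bool | ω e = true} (fun _ => (1 : ℝ)) := by
    ext ω; simp [coordInd, Set.indicator_apply]
  rw [h, integral_indicator .of_discrete]
  simp [measureReal_coord_true]

theorem integral_coordInd_mul [DecidableEq E] (e e' : E) :
    ∫ ω, coordInd e ω * coordInd e' ω ∂bernoulliPi q = if e = e' then (q e : ℝ) else q e * q e' := by
  split_ifs with h
  · subst h
    rw [← integral_coordInd q e]
    congr 1
    ext ω
    simp [coordInd]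
  · have hd : ∀ e : E, DependsOn (coordInd e) {e} := fun e x y hxy => by
      simp [coordInd, hxy e rfl]
    rw [integral_mul_of_dependsOn q (S := {e}) (T := {e'}) (by simpa using h) (hd e) (hd e'),
      integral_coordInd, integral_coordInd]

end BernoulliProduct

/-- Second moment method. Integrating the pointwise bound `2 c X ≤ X² + c² 1_{X ≠ 0}` at `c = C *
m`, with `m` the mean, replaces Cauchy–Schwarz. -/
theorem one_div_le_measureReal_ne_zero {Ω : Type*} [MeasurableSpace Ω] [Finite Ω]
    [MeasurableSingletonClass Ω] (μ : Measure Ω) [IsProbabilityMeasure μ] (X : Ω → ℝ) {C : ℝ}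
    (hC : 0 < C) (hpos : 0 < ∫ ω, X ω ∂μ)
    (h : ∫ ω, X ω * X ω ∂μ ≤ C * (∫ ω, X ω ∂μ) ^ 2) :
    1 / C ≤ μ.real {ω | X ω ≠ 0} := by
  set m := ∫ ω, X ω ∂μ with hm
  have hi : ∀ f : Ω → ℝ, Integrable f μ := fun f => .of_finite
  have h1 : ∫ ω, 2 * (C * m) * X ω ∂μ
      ≤ ∫ ω, (X ω * X ω + (C * m) ^ 2 * Set.indicator {ω | X ω ≠ 0} (fun _ => (1 : ℝ)) ω) ∂μ := by
    refine integral_mono (hi _) (hi _) fun ω => ?_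
    by_cases hx : X ω = 0
    · simp [hx]
    · simp only [Set.indicator_apply, Set.mem_ofPred_eq, ne_eq, hx, not_false_eq_true, if_true]
      nlinarith [sq_nonneg (X ω - C * m)]
  rw [integral_add (hi _) (hi _), integral_const_mul, integral_const_mul, ← hm,
    integral_indicator .of_discrete] at h1
  simp only [integral_const, smul_eq_mul, mul_one, measureReal_restrict_apply_univ] at h1
  rw [div_le_iff₀ hC]
  have h2 : C * m ^ 2 * 1 ≤ C * m ^ 2 * (μ.real {ω | X ω ≠ 0} * C) := by nlinarith
  exact le_of_mul_le_mul_left h2 (by positivity)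

theorem sum_sum_sum_mul {ι V : Type*} [Fintype V] (s : Finset ι) (f : ι → V → V → ℝ)
    (g : V → V → ℝ) :
    ∑ y, ∑ y', (∑ i ∈ s, f i y y') * g y y' = ∑ i ∈ s, ∑ y, ∑ y', f i y y' * g y y' := by
  rw [Finset.sum_comm]
  simp only [Finset.sum_mul]
  rw [Finset.sum_comm]
  calc ∑ y, ∑ y', ∑ i ∈ s, f i y y' * g y y'
      = ∑ y, ∑ i ∈ s, ∑ y', f i y y' * g y y' :=
        Finset.sum_congr rfl fun y _ => Finset.sum_comm
    _ = _ := Finset.sum_comm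

/-! ### Second moments of weighted counts of open walks. -/

section SplitKernel

variable {V : Type*} [Fintype V] [DecidableEq V] {Q : Matrix V V ℝ}

/-- The contribution to the covariance kernel of pairs of walks that meet in a vertex distributed
according to `d` and then take `k` separate steps. -/
def splitKernel (Q : Matrix V V ℝ) (k : ℕ) (d : V → ℝ) (z z' : V) : ℝ :=
  ∑ w, d w * ((Q ^ k) w z * (Q ^ k) w z')

theorem sum_splitKernel_mul (k : ℕ) (d : V → ℝ) (z z' : V) :
    ∑ y, ∑ y', splitKernel Q k d y y' * (Q y z * Q y' z') = splitKernel Q (k + 1) d z z' := by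
  have h : ∀ w, d w * ((Q ^ (k + 1)) w z * (Q ^ (k + 1)) w z') =
      ∑ y, ∑ y', d w * ((Q ^ k) w y * (Q ^ k) w y') * (Q y z * Q y' z') := fun w => by
    rw [pow_succ, Matrix.mul_apply, Matrix.mul_apply, Finset.sum_mul_sum, Finset.mul_sum]
    refine Finset.sum_congr rfl fun y _ => ?_
    rw [Finset.mul_sum]
    exact Finset.sum_congr rfl fun y' _ => by ring
  simp only [splitKernel, h]
  exact sum_sum_sum_mul _ (fun w y y' => d w * ((Q ^ k) w y * (Q ^ k) w y')) _

theorem matrix_pow_nonneg (hQ : ∀ y z, 0 < Q y z) (k : ℕ) (y z : V) : 0 ≤ (Q ^ k) y z := by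
  induction k generalizing z with
  | zero => rw [pow_zero, Matrix.one_apply]; positivity
  | succ k ih =>
    rw [pow_succ, Matrix.mul_apply]
    exact Finset.sum_nonneg fun w _ => mul_nonneg (ih w) (hQ w z).le

/-- Bounding one of the two separate walks by the largest entry of `Q ^ k` leaves a single walk, so
on the diagonal the kernel is controlled by a first moment. -/
theorem splitKernel_self_le (hQ : ∀ y z, 0 < Q y z) {k : ℕ} {b : ℝ} (hb : ∀ y z, (Q ^ k) y z ≤ b)
    {d : V → ℝ} (hd : ∀ w, 0 ≤ d w) (z : V) :
    splitKernel Q k d z z ≤ b * ∑ w, d w * (Q ^ k) w z := by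
  rw [splitKernel, Finset.mul_sum]
  refine Finset.sum_le_sum fun w _ => ?_
  have h1 := mul_le_mul_of_nonneg_right (hb w z) (matrix_pow_nonneg hQ k w z)
  have h2 := mul_le_mul_of_nonneg_left h1 (hd w)
  linarith

end SplitKernel

/-- The coordinates used by the first `j` steps. -/
def walkCoords {E V : Type*} (e : ℕ → V → V → E) (j : ℕ) : Set E := {x | ∃ i < j, ∃ y z, e i y z = x}

theorem disjoint_walkCoords {E V : Type*} {e : ℕ → V → V → E} {ℓ : ℕ}
    (hinj : ∀ i < ℓ, ∀ j < ℓ, ∀ y z y' z', e i y z = e j y' z' → i = j ∧ y = y' ∧ z = z')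
    {j : ℕ} (hj : j < ℓ) (y z y' z' : V) :
    Disjoint (walkCoords e j) {e j y z, e j y' z'} := by
  rw [Set.disjoint_left]
  rintro x ⟨i, hi, a, b, rfl⟩ h
  rcases h with h | h <;>
  · have := (hinj i (hi.trans hj) j hj _ _ _ _ h).1
    omega

section WalkWeight

open ProbabilityTheory

variable {E V : Type*} [Fintype V] [DecidableEq V]

/-- The total weight of the open walks that start at `u` and arrive at `z` after `j` steps, the
`i`-th step from `y` to `z` using the coordinate `e i y z` and having weight `Q y z`, normalized by
the probability that it is open. -/
noncomputable def walkWeight (q : E → unitInterval) (Q : Matrix V V ℝ) (e : ℕ → V → V → E) (u : V) :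
    ℕ → V → (E → Bool) → ℝ
  | 0, z, _ => if u = z then 1 else 0
  | j + 1, z, ω => ∑ y, walkWeight q Q e u j y ω * (Q y z / q (e j y z) * coordInd (e j y z) ω)

variable (q : E → unitInterval) (Q : Matrix V V ℝ) (e : ℕ → V → V → E) (u : V)

theorem dependsOn_walkWeight (j : ℕ) (z : V) :
    DependsOn (walkWeight q Q e u j z) (walkCoords e j) := by
  induction j generalizing z with
  | zero => intro x y _; rfl
  | succ j ih =>
    intro x y hxy
    simp only [walkWeight]
    refine Finset.sum_congr rfl fun w _ => ?_
    rw [ih w fun i ⟨k, hk, h⟩ => hxy i ⟨k, by omega, h⟩]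
    congr 2
    unfold coordInd
    rw [hxy (e j w z) ⟨j, by omega, w, z, rfl⟩]

/-- A nonzero weight forces an open walk; this extracts it in the form of an invariant propagated
along open steps. -/
theorem walkWeight_induction {ω : E → Bool} (P : ℕ → V → Prop) (h0 : P 0 u)
    (hs : ∀ j y z, P j y → ω (e j y z) = true → P (j + 1) z) (j : ℕ) (z : V)
    (h : walkWeight q Q e u j z ω ≠ 0) : P j z := by
  induction j generalizing z with
  | zero =>
    have : u = z := by
      by_contra hne
      exact h (by simp [walkWeight, hne])
    exact this ▸ h0
  | succ j ih =>
    obtain ⟨y, _, hy⟩ := Finset.exists_ne_zero_of_sum_ne_zero h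
    have h1 := left_ne_zero_of_mul hy
    have h2 := right_ne_zero_of_mul (right_ne_zero_of_mul hy)
    refine hs j y z (ih y h1) ?_
    by_contra hne
    exact h2 (by simp [coordInd, hne])

variable {q Q e u}

theorem walkWeight_nonneg (hQ : ∀ y z, 0 < Q y z) (j : ℕ) (z : V) (ω : E → Bool) :
    0 ≤ walkWeight q Q e u j z ω := by
  induction j generalizing z with
  | zero => simp only [walkWeight]; positivity
  | succ j ih =>
    refine Finset.sum_nonneg fun y _ => mul_nonneg (ih y) (mul_nonneg ?_ ?_)
    · exact div_nonneg (hQ _ _).le (unitInterval.nonneg _)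
    · unfold coordInd; positivity

variable [Fintype E] {ℓ : ℕ} {θ : ℝ}

theorem integral_walkWeight (hq0 : ∀ j < ℓ, ∀ y z, 0 < (q (e j y z) : ℝ))
    (hinj : ∀ i < ℓ, ∀ j < ℓ, ∀ y z y' z', e i y z = e j y' z' → i = j ∧ y = y' ∧ z = z')
    (j : ℕ) (hj : j ≤ ℓ) (z : V) :
    ∫ ω, walkWeight q Q e u j z ω ∂bernoulliPi q = (Q ^ j) u z := by
  induction j generalizing z with
  | zero => simp [walkWeight, Matrix.one_apply]
  | succ j ih =>
    simp only [walkWeight]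
    rw [integral_finsetSum _ fun _ _ => .of_finite, pow_succ, Matrix.mul_apply]
    refine Finset.sum_congr rfl fun y _ => ?_
    rw [integral_mul_of_dependsOn q (disjoint_walkCoords hinj (by omega) y z y z)
      (dependsOn_walkWeight q Q e u j y), ih (by omega), integral_const_mul, integral_coordInd,
      div_mul_cancel₀ _ (hq0 j (by omega) y z).ne']
    intro x x' h
    simp [coordInd, h (e j y z) (by simp)]

/-- The last steps of two walks are independent of the past, and of each other unless they are the
same edge. In that case squaring the indicator saves one edge probability, and `Q / q ≤ θ⁻¹` bounds
the resulting factor. -/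
theorem integral_walkWeight_mul_succ_le (hQ : ∀ y z, 0 < Q y z) (hθ : 0 < θ)
    (hq : ∀ j < ℓ, ∀ y z, θ * Q y z ≤ q (e j y z))
    (hinj : ∀ i < ℓ, ∀ j < ℓ, ∀ y z y' z', e i y z = e j y' z' → i = j ∧ y = y' ∧ z = z')
    (j : ℕ) (hj : j < ℓ) (z z' : V) :
    ∫ ω, walkWeight q Q e u (j + 1) z ω * walkWeight q Q e u (j + 1) z' ω ∂bernoulliPi q ≤
      (∑ y, ∑ y', (∫ ω, walkWeight q Q e u j y ω * walkWeight q Q e u j y' ω ∂bernoulliPi q) *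
        (Q y z * Q y' z')) +
      if z = z' then θ⁻¹ * ∑ y,
        (∫ ω, walkWeight q Q e u j y ω * walkWeight q Q e u j y ω ∂bernoulliPi q) * Q y z
      else 0 := by
  classical
  have hq0 : ∀ y z, 0 < (q (e j y z) : ℝ) := fun y z =>
    (mul_pos hθ (hQ y z)).trans_le (hq j hj y z)
  have hK0 : ∀ y y', 0 ≤ ∫ ω, walkWeight q Q e u j y ω * walkWeight q Q e u j y' ω ∂bernoulliPi q :=
    fun y y' => integral_nonneg fun ω =>
      mul_nonneg (walkWeight_nonneg hQ _ _ _) (walkWeight_nonneg hQ _ _ _)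
  have hstep : ∀ y y', ∫ ω, (Q y z / q (e j y z) * coordInd (e j y z) ω) *
      (Q y' z' / q (e j y' z') * coordInd (e j y' z') ω) ∂bernoulliPi q ≤
      Q y z * Q y' z' + if y = y' ∧ z = z' then θ⁻¹ * Q y z else 0 := by
    intro y y'
    have : ∀ ω, (Q y z / q (e j y z) * coordInd (e j y z) ω) *
      (Q y' z' / q (e j y' z') * coordInd (e j y' z') ω) =
      (Q y z / q (e j y z)) * (Q y' z' / q (e j y' z')) *
        (coordInd (e j y z) ω * coordInd (e j y' z') ω) := fun ω => by ring
    simp only [this]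
    rw [integral_const_mul, integral_coordInd_mul]
    have p1 := hq0 y z
    have p2 := hq0 y' z'
    by_cases h : y = y' ∧ z = z'
    · obtain ⟨rfl, rfl⟩ := h
      simp only [if_true, and_self]
      have h3 : Q y z / q (e j y z) ≤ θ⁻¹ := by
        rw [div_le_iff₀ p1, ← div_eq_inv_mul, le_div_iff₀ hθ]
        linarith [hq j hj y z]
      have h4 : Q y z / q (e j y z) * (Q y z / q (e j y z)) * q (e j y z)
          = Q y z / q (e j y z) * Q y z := by
        field_simp
      rw [h4]
      have := mul_le_mul_of_nonneg_right h3 (hQ y z).le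
      have := mul_pos (hQ y z) (hQ y z)
      linarith
    · rw [if_neg h, if_neg fun h' => h (hinj j hj j hj _ _ _ _ h').2]
      apply le_of_eq
      field_simp
      ring
  have hexp : ∀ ω, walkWeight q Q e u (j + 1) z ω * walkWeight q Q e u (j + 1) z' ω =
      ∑ y, ∑ y', (walkWeight q Q e u j y ω * walkWeight q Q e u j y' ω) *
        ((Q y z / q (e j y z) * coordInd (e j y z) ω) *
      (Q y' z' / q (e j y' z') * coordInd (e j y' z') ω)) := fun ω => by
    simp only [walkWeight]
    rw [Finset.sum_mul_sum]
    exact Finset.sum_congr rfl fun _ _ => Finset.sum_congr rfl fun _ _ => by ring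
  simp only [hexp]
  rw [integral_finsetSum _ fun _ _ => .of_finite]
  have hterm : ∀ y, ∫ ω, ∑ y', (walkWeight q Q e u j y ω * walkWeight q Q e u j y' ω) *
        ((Q y z / q (e j y z) * coordInd (e j y z) ω) *
      (Q y' z' / q (e j y' z') * coordInd (e j y' z') ω)) ∂bernoulliPi q ≤
      ∑ y', ((∫ ω, walkWeight q Q e u j y ω * walkWeight q Q e u j y' ω ∂bernoulliPi q) *
        (Q y z * Q y' z') + if y = y' ∧ z = z' then
        (∫ ω, walkWeight q Q e u j y ω * walkWeight q Q e u j y ω ∂bernoulliPi q) * (θ⁻¹ * Q y z)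
        else 0) := by
    intro y
    rw [integral_finsetSum _ fun _ _ => .of_finite]
    refine Finset.sum_le_sum fun y' _ => ?_
    rw [integral_mul_of_dependsOn q (disjoint_walkCoords hinj hj y z y' z')]
    · refine (mul_le_mul_of_nonneg_left (hstep y y') (hK0 y y')).trans_eq ?_
      rw [mul_add]
      congr 1
      split_ifs with h
      · rw [h.1]
      · simp
    · intro x x' h
      simp only [dependsOn_walkWeight q Q e u j y h, dependsOn_walkWeight q Q e u j y' h]
    · intro x x' h
      simp [coordInd, h (e j y z) (by simp), h (e j y' z') (by simp)]
  refine (Finset.sum_le_sum fun y _ => hterm y).trans_eq ?_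
  simp only [Finset.sum_add_distrib]
  congr 1
  split_ifs with h
  · rw [Finset.mul_sum]
    refine Finset.sum_congr rfl fun y _ => ?_
    simp only [h, and_true, Finset.sum_ite_eq, Finset.mem_univ, if_true]
    ring
  · simp [h]

end WalkWeight

section Covariance

open ProbabilityTheory

variable {E V : Type*} [Fintype E] [Fintype V] [DecidableEq V] {q : E → unitInterval}
  {Q : Matrix V V ℝ} {e : ℕ → V → V → E} {u : V} {ℓ : ℕ} {θ : ℝ}

theorem splitKernel_pow_le (hQ : ∀ y z, 0 < Q y z) {M B : ℕ → ℝ}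
    (hM : ∀ k y z, (Q ^ k) y z ≤ M k) (hB0 : ∀ j, 0 ≤ B j) (hθ : 0 < θ) (j : ℕ) (z : V) :
    splitKernel Q j (Pi.single u 1) z z + θ⁻¹ * ∑ i ∈ Finset.range j,
        B i * splitKernel Q (j - 1 - i) (fun w => (Q ^ (i + 1)) u w) z z ≤
      (M j + θ⁻¹ * ∑ i ∈ Finset.range j, B i * M (j - 1 - i)) * (Q ^ j) u z := by
  rw [add_mul, mul_assoc, Finset.sum_mul]
  refine add_le_add ?_ (mul_le_mul_of_nonneg_left (Finset.sum_le_sum fun i hi => ?_)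
    (inv_nonneg.2 hθ.le))
  · refine (splitKernel_self_le hQ (hM j) (fun w => ?_) z).trans_eq ?_
    · rw [Pi.single_apply]; positivity
    · simp [Pi.single_apply]
  · rw [mul_assoc]
    refine mul_le_mul_of_nonneg_left ?_ (hB0 i)
    refine (splitKernel_self_le hQ (hM _) (fun w => matrix_pow_nonneg hQ _ _ _) z).trans_eq ?_
    rw [← Matrix.mul_apply, ← pow_add]
    have := Finset.mem_range.1 hi
    congr 2
    rw [show i + 1 + (j - 1 - i) = j by omega]

/-- Unrolls the one-step recursion: pairs of walks are sorted by the last edge they share. Term `i`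
shares step `i` and then moves separately for `j - 1 - i` steps; `B i` bounds the second moment at
time `i` relative to the mean `(Q ^ i) u y`, and the condition on `B` is what lets this bound
persist. -/
theorem integral_walkWeight_mul_le (hQ : ∀ y z, 0 < Q y z) (hθ : 0 < θ)
    (hq : ∀ j < ℓ, ∀ y z, θ * Q y z ≤ q (e j y z))
    (hinj : ∀ i < ℓ, ∀ j < ℓ, ∀ y z y' z', e i y z = e j y' z' → i = j ∧ y = y' ∧ z = z')
    {M B : ℕ → ℝ} (hM : ∀ k y z, (Q ^ k) y z ≤ M k) (hB0 : ∀ j, 0 ≤ B j)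
    (hB : ∀ j, M j + θ⁻¹ * ∑ i ∈ Finset.range j, B i * M (j - 1 - i) ≤ B j)
    (j : ℕ) (hj : j ≤ ℓ) (z z' : V) :
    ∫ ω, walkWeight q Q e u j z ω * walkWeight q Q e u j z' ω ∂bernoulliPi q ≤
      splitKernel Q j (Pi.single u 1) z z' + θ⁻¹ * ∑ i ∈ Finset.range j,
        B i * splitKernel Q (j - 1 - i) (fun w => (Q ^ (i + 1)) u w) z z' := by
  induction j generalizing z z' with
  | zero =>
    simp only [walkWeight, splitKernel, pow_zero, Matrix.one_apply, Pi.single_apply]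
    by_cases h : u = z
    · subst h
      by_cases h' : u = z'
      · subst h'
        simp
      · simp [h', Ne.symm h']
    · have : ∀ w, (if w = u then (1 : ℝ) else 0) * ((if w = z then 1 else 0) *
          if w = z' then 1 else 0) = 0 := fun w => by
        by_cases hw : w = u
        · subst hw; simp [h]
        · simp [hw]
      rw [Finset.sum_eq_zero fun w _ => this w]
      simp [h]
  | succ j ih =>
    refine (integral_walkWeight_mul_succ_le hQ hθ hq hinj j (by omega) z z').trans ?_
    have h1 := Finset.sum_le_sum fun y (_ : y ∈ Finset.univ) =>
      Finset.sum_le_sum fun y' (_ : y' ∈ Finset.univ) =>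
      mul_le_mul_of_nonneg_right (ih (by omega) y y') (mul_nonneg (hQ y z).le (hQ y' z').le)
    have e1 : ∀ i ∈ Finset.range j, splitKernel Q (j + 1 - 1 - i) (fun w => (Q ^ (i + 1)) u w) z z'
        = splitKernel Q (j - 1 - i + 1) (fun w => (Q ^ (i + 1)) u w) z z' := fun i hi => by
      have := Finset.mem_range.1 hi
      congr 1
      omega
    rw [Finset.sum_range_succ, mul_add, ← add_assoc]
    refine add_le_add (h1.trans_eq ?_) ?_
    · simp only [add_mul, Finset.sum_add_distrib, sum_splitKernel_mul]
      congr 1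
      have e2 : ∀ y y', (θ⁻¹ * ∑ i ∈ Finset.range j,
          B i * splitKernel Q (j - 1 - i) (fun w => (Q ^ (i + 1)) u w) y y') * (Q y z * Q y' z') =
          (∑ i ∈ Finset.range j, θ⁻¹ * B i *
            splitKernel Q (j - 1 - i) (fun w => (Q ^ (i + 1)) u w) y y') * (Q y z * Q y' z') := by
        intro y y'
        simp only [Finset.mul_sum, mul_assoc]
      simp only [e2]
      rw [sum_sum_sum_mul (Finset.range j) (fun i y y' => θ⁻¹ * B i *
        splitKernel Q (j - 1 - i) (fun w => (Q ^ (i + 1)) u w) y y') fun y y' => Q y z * Q y' z',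
        Finset.mul_sum]
      refine Finset.sum_congr rfl fun i hi => ?_
      rw [e1 i hi, ← sum_splitKernel_mul]
      simp only [Finset.mul_sum, mul_assoc]
    · have hz : splitKernel Q (j + 1 - 1 - j) (fun w => (Q ^ (j + 1)) u w) z z' =
          if z = z' then (Q ^ (j + 1)) u z else 0 := by
        simp only [splitKernel, Nat.add_sub_cancel, Nat.sub_self, pow_zero, Matrix.one_apply]
        by_cases h : z = z'
        · subst h; simp
        · have : ∀ w, ((if w = z then (1 : ℝ) else 0) * if w = z' then 1 else 0) = 0 := fun w => by
            by_cases hw : w = z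
            · subst hw; simp [h]
            · simp [hw]
          simp [h, this]
      rw [hz]
      split_ifs with h
      · refine mul_le_mul_of_nonneg_left ?_ (inv_nonneg.2 hθ.le)
        rw [pow_succ, Matrix.mul_apply, Finset.mul_sum]
        refine Finset.sum_le_sum fun y _ => ?_
        rw [← mul_assoc]
        refine mul_le_mul_of_nonneg_right ((ih (by omega) y y).trans
          ((splitKernel_pow_le hQ hM hB0 hθ j y).trans ?_)) (hQ y z).le
        exact mul_le_mul_of_nonneg_right (hB j) (matrix_pow_nonneg hQ _ _ _)
      · simp

/-- The second moment method for the walks from `u` to `v` of length `ℓ`. -/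
theorem le_measureReal_walkWeight_ne_zero (hQ : ∀ y z, 0 < Q y z) (hθ : 0 < θ)
    (hq : ∀ j < ℓ, ∀ y z, θ * Q y z ≤ q (e j y z))
    (hinj : ∀ i < ℓ, ∀ j < ℓ, ∀ y z y' z', e i y z = e j y' z' → i = j ∧ y = y' ∧ z = z')
    {M B : ℕ → ℝ} (hM : ∀ k y z, (Q ^ k) y z ≤ M k) (hB0 : ∀ j, 0 ≤ B j)
    (hB : ∀ j, M j + θ⁻¹ * ∑ i ∈ Finset.range j, B i * M (j - 1 - i) ≤ B j) {v : V} {D : ℝ}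
    (hpos : 0 < (Q ^ ℓ) u v) (hD0 : 0 ≤ D)
    (hD : θ⁻¹ * ∑ i ∈ Finset.range ℓ, B i * M (ℓ - 1 - i) ≤ D * (Q ^ ℓ) u v) :
    1 / (1 + D) ≤ (bernoulliPi q).real {ω | walkWeight q Q e u ℓ v ω ≠ 0} := by
  have hE := integral_walkWeight (q := q) (Q := Q) (u := u)
    (fun j hj y z => (mul_pos hθ (hQ y z)).trans_le (hq j hj y z)) hinj ℓ le_rfl v
  refine one_div_le_measureReal_ne_zero _ _ (by positivity) (hE ▸ hpos) ?_
  rw [hE]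
  refine (integral_walkWeight_mul_le hQ hθ hq hinj hM hB0 hB ℓ le_rfl v v).trans ?_
  have h1 : splitKernel Q ℓ (Pi.single u 1) v v = (Q ^ ℓ) u v ^ 2 := by
    simp [splitKernel, Pi.single_apply, sq]
  have h2 : θ⁻¹ * ∑ i ∈ Finset.range ℓ,
      B i * splitKernel Q (ℓ - 1 - i) (fun w => (Q ^ (i + 1)) u w) v v ≤
      (θ⁻¹ * ∑ i ∈ Finset.range ℓ, B i * M (ℓ - 1 - i)) * (Q ^ ℓ) u v := by
    rw [mul_assoc, Finset.sum_mul]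
    refine mul_le_mul_of_nonneg_left (Finset.sum_le_sum fun i hi => ?_) (inv_nonneg.2 hθ.le)
    rw [mul_assoc]
    refine mul_le_mul_of_nonneg_left ?_ (hB0 i)
    refine (splitKernel_self_le hQ (hM _) (fun w => matrix_pow_nonneg hQ _ _ _) v).trans_eq ?_
    rw [← Matrix.mul_apply, ← pow_add]
    have := Finset.mem_range.1 hi
    congr 2
    rw [show i + 1 + (ℓ - 1 - i) = ℓ by omega]
  rw [h1]
  have := mul_le_mul_of_nonneg_right hD hpos.le
  nlinarith

end Covariance

/-! ### Tensor powers of the symmetric initiator. -/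

section TensorPower

/-- The tensor power of a matrix. -/
def tensorPow {κ : Type*} (A : Matrix κ κ ℝ) (ι : Type*) [Fintype ι] : Matrix (ι → κ) (ι → κ) ℝ :=
  Matrix.of fun x y => ∏ i, A (x i) (y i)

variable {κ : Type*} [Fintype κ] [DecidableEq κ] (A : Matrix κ κ ℝ) (ι : Type*) [Fintype ι]
  [DecidableEq ι]

theorem tensorPow_pow (k : ℕ) : tensorPow A ι ^ k = tensorPow (A ^ k) ι := by
  induction k with
  | zero =>
    ext x y
    simp only [pow_zero, tensorPow, Matrix.of_apply, Matrix.one_apply, Finset.prod_ite_zero,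
      Finset.prod_const_one, funext_iff, Finset.mem_univ, true_imp_iff]
  | succ k ih =>
    ext x y
    rw [pow_succ, ih, Matrix.mul_apply]
    simp only [tensorPow, Matrix.of_apply, pow_succ, Matrix.mul_apply, Finset.prod_univ_sum,
      Fintype.piFinset_univ, Finset.prod_mul_distrib]

end TensorPower

theorem pow_symm_two_apply (g b : ℝ) (k : ℕ) (x y : Fin 2) :
    ((!![g, b; b, g] : Matrix (Fin 2) (Fin 2) ℝ) ^ k) x y =
      if x = y then ((g + b) ^ k + (g - b) ^ k) / 2 else ((g + b) ^ k - (g - b) ^ k) / 2 := by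
  induction k generalizing x y with
  | zero => fin_cases x <;> fin_cases y <;> simp
  | succ k ih =>
    rw [pow_succ, Matrix.mul_apply, Fin.sum_univ_two, ih, ih]
    fin_cases x <;> fin_cases y <;> simp <;> ring

/-- The eigenvalues are `g + b` and `g - b`; the second contributes the error. -/
theorem abs_pow_symm_two_apply_sub_le (g b : ℝ) (hs : 0 < g + b) (k : ℕ) (x y : Fin 2) :
    |((!![g, b; b, g] : Matrix (Fin 2) (Fin 2) ℝ) ^ k) x y - (g + b) ^ k / 2| ≤
      (g + b) ^ k * (|g - b| / (g + b)) ^ k / 2 := by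
  have h1 : (g + b) ^ k * (|g - b| / (g + b)) ^ k = |(g - b) ^ k| := by
    rw [← mul_pow, mul_div_cancel₀ _ hs.ne', abs_pow]
  rw [pow_symm_two_apply, h1]
  split_ifs
  · rw [show ((g + b) ^ k + (g - b) ^ k) / 2 - (g + b) ^ k / 2 = (g - b) ^ k / 2 by ring, abs_div]
    norm_num
  · rw [show ((g + b) ^ k - (g - b) ^ k) / 2 - (g + b) ^ k / 2 = -((g - b) ^ k / 2) by ring,
      abs_neg, abs_div]
    norm_num

/-- The majorant is `f k = max (σ / 2) (p ^ (k + 1))` with `p` just below `1`. It decays slowly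
enough to dominate the true entries for small `k`, yet reaches the limiting level `σ / 2` by time
`ℓ`. The slack `σ ^ 4 < s` pays for all losses, since a shared step gains a factor `s` per
coordinate. -/
theorem exists_growth_constants {s ρ : ℝ} (hs1 : 1 < s) (hs2 : s ≤ 2) (hρ0 : 0 ≤ ρ) (hρ1 : ρ < 1) :
    ∃ σ : ℝ, 1 < σ ∧ σ ^ 4 < s ∧ ∃ f : ℕ → ℝ, (∀ k, 0 < f k) ∧
      (∀ k, (1 + ρ ^ k) / 2 ≤ σ * f k) ∧ (∀ i k, f i * f k ≤ f (i + k + 1)) ∧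
      ∃ ℓ : ℕ, 3 ≤ ℓ ∧ f ℓ = σ / 2 ∧ 1 / (2 * σ) ≤ (1 - ρ ^ ℓ) / 2 := by
  obtain ⟨t, ht⟩ : ∃ t, t = (s - 1) / 16 := ⟨_, rfl⟩
  have ht0 : 0 < t := by linarith
  have ht1 : t ≤ 1 / 16 := by linarith
  set σ := 1 + t with hσ
  have hσ1 : 1 < σ := by linarith
  have hσ2 : σ ^ 4 < s := by
    have : s = 1 + 16 * t := by linarith
    rw [this, hσ]
    have h2 : t ^ 2 ≤ t := by nlinarith
    have h3 : t ^ 3 ≤ t := by nlinarith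
    have h4 : t ^ 4 ≤ t := by nlinarith [sq_nonneg t]
    nlinarith
  have hinv : σ⁻¹ < 1 := inv_lt_one_of_one_lt₀ hσ1
  have hinv0 : 0 < σ⁻¹ := by positivity
  have hρ := tendsto_pow_atTop_nhds_zero_of_lt_one hρ0 hρ1
  -- From `K` on, `(1 + ρ ^ k) / 2 ≤ σ ^ 2 / 2`, so the constant branch of `f` suffices; before `K`,
  -- Bernoulli's inequality will give `p ^ K ≥ σ⁻¹`.
  obtain ⟨K, hK⟩ := (hρ.eventually_le_const (u := σ ^ 2 - 1) (by nlinarith)).exists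
  set p : ℝ := 1 - (1 - σ⁻¹) / (K + 1) with hp
  have hd0 : 0 < (1 - σ⁻¹) / (K + 1) := by
    have : 0 < 1 - σ⁻¹ := by linarith
    positivity
  have hd1 : (1 - σ⁻¹) / (K + 1) ≤ 1 - σ⁻¹ := by
    refine div_le_self (by linarith) ?_
    have : (0 : ℝ) ≤ K := Nat.cast_nonneg K
    linarith
  have hp0 : 0 < p := by linarith
  have hp1 : p < 1 := by linarith
  have hpK : σ⁻¹ ≤ p ^ K := by
    have h := one_add_mul_le_pow (a := -((1 - σ⁻¹) / (K + 1))) (by linarith) K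
    have h2 : (K : ℝ) * ((1 - σ⁻¹) / (K + 1)) ≤ 1 - σ⁻¹ := by
      rw [mul_div_assoc', div_le_iff₀ (by positivity)]
      nlinarith
    have h3 : 1 + -((1 - σ⁻¹) / (K + 1)) = p := by rw [hp]; ring
    rw [h3] at h
    linarith
  have hr1 : σ / 2 ≤ 1 := by linarith
  have hpp := tendsto_pow_atTop_nhds_zero_of_lt_one hp0.le hp1
  obtain ⟨ℓ, h3, hℓ1, hℓ2⟩ := ((eventually_ge_atTop 3).and
    ((hpp.eventually_le_const (u := σ / 2) (by positivity)).and
    (hρ.eventually_le_const (u := 1 - σ⁻¹) (by linarith)))).exists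
  refine ⟨σ, hσ1, hσ2, fun k => max (σ / 2) (p ^ (k + 1)), fun k => by positivity, fun k => ?_,
    fun i k => ?_, ℓ, h3, ?_, ?_⟩
  · rcases le_or_gt K k with h | h
    · have h1 : ρ ^ k ≤ ρ ^ K := pow_le_pow_of_le_one hρ0 hρ1.le h
      have h2 := mul_le_mul_of_nonneg_left (le_max_left (σ / 2) (p ^ (k + 1)))
        (by positivity : 0 ≤ σ)
      nlinarith
    · have h1 : ρ ^ k ≤ 1 := pow_le_one₀ hρ0 hρ1.le
      have h2 : p ^ K ≤ p ^ (k + 1) := pow_le_pow_of_le_one hp0.le hp1.le h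
      have h4 := mul_le_mul_of_nonneg_left (hpK.trans (h2.trans (le_max_right (σ / 2) _)))
        (by positivity : 0 ≤ σ)
      rw [mul_inv_cancel₀ (by positivity)] at h4
      linarith
  · have a1 : p ^ (i + 1) ≤ 1 := pow_le_one₀ hp0.le hp1.le
    have a2 : p ^ (k + 1) ≤ 1 := pow_le_one₀ hp0.le hp1.le
    rcases le_total (σ / 2) (p ^ (i + 1)) with h | h <;>
    rcases le_total (σ / 2) (p ^ (k + 1)) with h' | h' <;>
    simp only [h, h', max_eq_left, max_eq_right]
    · refine le_max_of_le_right ?_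
      rw [← pow_add]
      exact le_of_eq (by ring)
    · exact le_max_of_le_left (mul_le_of_le_one_left (by positivity) a1)
    · exact le_max_of_le_left (mul_le_of_le_one_right (by positivity) a2)
    · exact le_max_of_le_left (mul_le_of_le_one_right (by positivity) hr1)
  · refine max_eq_left (le_trans ?_ hℓ1)
    exact pow_le_pow_of_le_one hp0.le hp1.le (by omega)
  · rw [one_div, mul_inv]
    linarith

/-! ### Uniform success probability for walks in the tensor power. -/

section TensorWalk

variable {E ι : Type*} [Fintype E] [Fintype ι] [DecidableEq ι] {q : E → unitInterval}
  {e : ℕ → (ι → Fin 2) → (ι → Fin 2) → E} {ℓ : ℕ} {θ g b σ : ℝ} {f : ℕ → ℝ}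

theorem le_measureReal_tensorWalk (hg : 0 < g) (hb : 0 < b) (hσ : 1 < σ) (hf : ∀ k, 0 < f k)
    (hρf : ∀ k, (1 + (|g - b| / (g + b)) ^ k) / 2 ≤ σ * f k)
    (hff : ∀ i k, f i * f k ≤ f (i + k + 1)) (hfℓ : f ℓ = σ / 2)
    (hρℓ : 1 / (2 * σ) ≤ (1 - (|g - b| / (g + b)) ^ ℓ) / 2) (hθ : 0 < θ)
    (hθσ : (σ ^ 4) ^ Fintype.card ι ≤ θ * (g + b) ^ Fintype.card ι)
    (hq : ∀ j < ℓ, ∀ y z, θ * tensorPow !![g, b; b, g] ι y z ≤ q (e j y z))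
    (hinj : ∀ i < ℓ, ∀ j < ℓ, ∀ y z y' z', e i y z = e j y' z' → i = j ∧ y = y' ∧ z = z')
    (u v : ι → Fin 2) :
    1 / (1 + 2 ^ ℓ) ≤ (bernoulliPi q).real
      {ω | walkWeight q (tensorPow !![g, b; b, g] ι) e u ℓ v ω ≠ 0} := by
  set d := Fintype.card ι with hd
  set s := g + b with hs
  have hs0 : 0 < s := by positivity
  have hσ0 : 0 < σ := by linarith
  have hentry : ∀ k (x y : Fin 2), ((!![g, b; b, g] : Matrix (Fin 2) (Fin 2) ℝ) ^ k) x y ≤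
      s ^ k * (σ * f k) := fun k x y => by
    have h1 := (abs_le.1 (abs_pow_symm_two_apply_sub_le g b hs0 k x y)).2
    have h2 := mul_le_mul_of_nonneg_left (hρf k) (pow_pos hs0 k).le
    rw [← hs] at h1
    linarith
  have hentry' : ∀ (x y : Fin 2), s ^ ℓ * (1 / (2 * σ)) ≤
      ((!![g, b; b, g] : Matrix (Fin 2) (Fin 2) ℝ) ^ ℓ) x y := fun x y => by
    have h1 := (abs_le.1 (abs_pow_symm_two_apply_sub_le g b hs0 ℓ x y)).1
    have h2 := mul_le_mul_of_nonneg_left hρℓ (pow_pos hs0 ℓ).le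
    rw [← hs] at h1
    linarith
  have hNpos : ∀ x y, 0 < (!![g, b; b, g] : Matrix (Fin 2) (Fin 2) ℝ) x y := by
    intro x y; fin_cases x <;> fin_cases y <;> simpa
  have hQ : ∀ y z, 0 < tensorPow !![g, b; b, g] ι y z := fun y z =>
    Finset.prod_pos fun i _ => hNpos _ _
  have hpow0 : ∀ k x y, 0 ≤ ((!![g, b; b, g] : Matrix (Fin 2) (Fin 2) ℝ) ^ k) x y :=
    fun k x y => matrix_pow_nonneg hNpos k x y
  have hM : ∀ k y z, (tensorPow !![g, b; b, g] ι ^ k) y z ≤ (s ^ k * (σ * f k)) ^ d := by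
    intro k y z
    rw [tensorPow_pow]
    refine (Finset.prod_le_prod (fun i _ => hpow0 k _ _) fun i _ => hentry k _ _).trans_eq ?_
    rw [Finset.prod_const, hd, Finset.card_univ]
  have hlow : (s ^ ℓ * (1 / (2 * σ))) ^ d ≤ (tensorPow !![g, b; b, g] ι ^ ℓ) u v := by
    rw [tensorPow_pow, hd, ← Finset.card_univ, ← Finset.prod_const]
    exact Finset.prod_le_prod (fun i _ => by positivity) fun i _ => hentry' _ _
  -- A shared step costs `θ⁻¹` but saves `s` per coordinate. As `θ * s ^ d ≥ (σ ^ 4) ^ d`, this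
  -- absorbs the two factors `σ` of the entry bounds and leaves `σ⁻²` to spare.
  have hterm : ∀ j, ∀ i ∈ Finset.range j,
      θ⁻¹ * (2 ^ i * (s ^ i * (σ * f i)) ^ d * (s ^ (j - 1 - i) * (σ * f (j - 1 - i))) ^ d) ≤
      2 ^ i * (s ^ j * (f j / σ ^ 2)) ^ d := by
    intro j i hi
    have hij := Finset.mem_range.1 hi
    obtain ⟨k, rfl⟩ : ∃ k, j = i + k + 1 := ⟨j - 1 - i, by omega⟩
    rw [show i + k + 1 - 1 - i = k by omega, inv_mul_le_iff₀ hθ]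
    have h1 : (σ ^ 4 * (s ^ i * s ^ k * (f i * f k) / σ ^ 2)) ^ d ≤
        (θ * s ^ d) * (s ^ i * s ^ k * f (i + k + 1) / σ ^ 2) ^ d := by
      rw [mul_pow]
      refine mul_le_mul hθσ (pow_le_pow_left₀ ?_ ?_ d) ?_ (by positivity)
      · have := hf i; have := hf k; positivity
      · gcongr
        exact hff i k
      · have := hf i; have := hf k; positivity
    calc _ = 2 ^ i * (σ ^ 4 * (s ^ i * s ^ k * (f i * f k) / σ ^ 2)) ^ d := by
          rw [mul_assoc, ← mul_pow]
          congr 2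
          field_simp
      _ ≤ 2 ^ i * ((θ * s ^ d) * (s ^ i * s ^ k * f (i + k + 1) / σ ^ 2) ^ d) := by gcongr
      _ = _ := by
          rw [mul_assoc θ, ← mul_pow, mul_left_comm]
          congr 3
          rw [pow_succ, pow_add]
          ring
  have hsum : ∀ j, θ⁻¹ * ∑ i ∈ Finset.range j,
      2 ^ i * (s ^ i * (σ * f i)) ^ d * (s ^ (j - 1 - i) * (σ * f (j - 1 - i))) ^ d ≤
      (2 ^ j - 1) * (s ^ j * (f j / σ ^ 2)) ^ d := by
    intro j
    rw [Finset.mul_sum]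
    refine (Finset.sum_le_sum (hterm j)).trans_eq ?_
    rw [← Finset.sum_mul, geom_sum_eq (by norm_num)]
    norm_num
  have hf0 : ∀ j, 0 ≤ s ^ j * (σ * f j) := fun j => by have := hf j; positivity
  have hp2 : ∀ j : ℕ, (0 : ℝ) ≤ 2 ^ j - 1 := fun j => by
    have := one_le_pow₀ (one_le_two : (1 : ℝ) ≤ 2) (n := j)
    linarith
  -- The factor `2 ^ j` in `B` closes the recursion because the `2 ^ i` with `i < j` sum to `2 ^ j -
  -- 1`. At time `ℓ`, `f ℓ / σ ^ 2 = 1 / (2 * σ)` matches the lower bound on the entries, so `D = 2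
  -- ^ ℓ` works.
  refine le_measureReal_walkWeight_ne_zero (M := fun k => (s ^ k * (σ * f k)) ^ d)
    (B := fun j => 2 ^ j * (s ^ j * (σ * f j)) ^ d) hQ hθ hq hinj hM
    (fun j => by have := hf0 j; positivity) (fun j => ?_) (lt_of_lt_of_le (by positivity) hlow)
    (by positivity) ?_
  · have h1 : (s ^ j * (f j / σ ^ 2)) ^ d ≤ (s ^ j * (σ * f j)) ^ d := by
      have := hf j
      refine pow_le_pow_left₀ (by positivity) ?_ d
      gcongr
      rw [div_le_iff₀ (by positivity)]
      have : 1 ≤ σ ^ 3 := one_le_pow₀ hσ.le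
      nlinarith
    have := (hsum j).trans (mul_le_mul_of_nonneg_left h1 (hp2 j))
    linarith
  · refine (hsum ℓ).trans ?_
    have h1 : s ^ ℓ * (f ℓ / σ ^ 2) = s ^ ℓ * (1 / (2 * σ)) := by
      rw [hfℓ]; field_simp
    rw [h1]
    have : (0 : ℝ) ≤ (s ^ ℓ * (1 / (2 * σ))) ^ d := by positivity
    nlinarith [hp2 ℓ, pow_pos (two_pos : (0 : ℝ) < 2) ℓ]

end TensorWalk

/-! ### From edge indicators to distances and the diameter. -/

theorem edgeProb_mk (n : ℕ) (α β γ : unitInterval) (u v : KVertex n) :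
    (edgeProb n α β γ s(u, v) : ℝ) = ∏ i, (initiator α β γ (u i) (v i) : ℝ) := by
  rw [edgeProb, Sym2.lift_mk]
  exact map_prod unitInterval.submonoid.subtype _ _

/-- Degenerate pairs are allowed, so a walk that stalls needs no separate treatment. -/
theorem edist_le_one_of_eq_true {n : ℕ} {ω : Sym2 (KVertex n) → Bool} {u v : KVertex n}
    (h : ω s(u, v) = true) : (kroneckerGraph n ω).edist u v ≤ 1 := by
  rw [SimpleGraph.edist_le_one_iff_adj_or_eq]
  by_cases huv : u = v
  · exact Or.inr huv
  · exact Or.inl ⟨h, huv⟩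

/-- Union bound over the `4 ^ n` ordered pairs of vertices. -/
theorem tendsto_measure_ediam_le {α β γ : unitInterval} {a : ℕ} {ε : ℕ → ℝ}
    (hε : Tendsto (fun n => 4 ^ n * ε n) atTop (𝓝 0))
    (h : ∀ᶠ n in atTop, ∀ u v : KVertex n,
      (kroneckerMeasure n α β γ).real {ω | (a : ℕ∞) < (kroneckerGraph n ω).edist u v} ≤ ε n) :
    Tendsto (fun n : ℕ => kroneckerMeasure n α β γ {ω | (kroneckerGraph n ω).ediam ≤ (a : ℕ∞)})
      atTop (𝓝 1) := by
  have hp : ∀ n, IsProbabilityMeasure (kroneckerMeasure n α β γ) := fun n => by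
    unfold kroneckerMeasure; infer_instance
  have key : Tendsto (fun n : ℕ =>
      (kroneckerMeasure n α β γ).real {ω | (kroneckerGraph n ω).ediam ≤ (a : ℕ∞)})
      atTop (𝓝 1) := by
    refine tendsto_of_tendsto_of_tendsto_of_le_of_le' (g := fun n => 1 - 4 ^ n * ε n)
      (h := fun _ => 1) (by simpa using tendsto_const_nhds.sub hε) tendsto_const_nhds ?_
      (Eventually.of_forall fun n => measureReal_le_one)
    filter_upwards [h] with n hn
    have hc := probReal_compl_eq_one_sub (μ := kroneckerMeasure n α β γ)
      (s := {ω | (kroneckerGraph n ω).ediam ≤ (a : ℕ∞)}) .of_discrete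
    have hsub : {ω | (kroneckerGraph n ω).ediam ≤ (a : ℕ∞)}ᶜ ⊆
        ⋃ p : KVertex n × KVertex n, {ω | (a : ℕ∞) < (kroneckerGraph n ω).edist p.1 p.2} := by
      intro ω hω
      simp only [Set.mem_compl_iff, Set.mem_ofPred_eq, SimpleGraph.ediam_le_iff, not_forall,
        not_le] at hω
      obtain ⟨u, v, huv⟩ := hω
      exact Set.mem_iUnion.2 ⟨(u, v), huv⟩
    have h1 := (measureReal_mono hsub).trans
      ((measureReal_iUnion_fintype_le (μ := kroneckerMeasure n α β γ) _).trans
      (Finset.sum_le_sum fun p _ => hn p.1 p.2))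
    rw [Finset.sum_const, Finset.card_univ, Fintype.card_prod, Fintype.card_fun, Fintype.card_fin,
      Fintype.card_fin, nsmul_eq_mul, ← mul_pow] at h1
    push_cast at h1
    linarith
  have := (ENNReal.continuous_ofReal.tendsto 1).comp key
  simpa [Function.comp_def] using this

/-! ### Edge-disjoint families of walks obtained by labelling vertices. -/

section Universes

variable {m ℓ R : ℕ} {a b : Fin m → Fin 2}

/-- The prefixes of the vertices of the `r`-th family of walks of length `ℓ`: starting with `a`,
ending with `b`, and with codes `c` in between. -/
def walkPrefix (ℓ : ℕ) (a b : Fin m → Fin 2) (c : Fin R × Fin ℓ → Fin m → Fin 2) (r : Fin R)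
    (j : ℕ) : Fin m → Fin 2 :=
  if j = 0 then a else if h : j < ℓ then c (r, ⟨j, h⟩) else b

theorem walkPrefix_inj {c : Fin R × Fin ℓ → Fin m → Fin 2} (hc : Function.Injective c)
    (hab : ∀ p, c p ≠ a ∧ c p ≠ b) {r r' : Fin R} {i j : ℕ} (hi0 : i ≠ 0) (hi : i < ℓ)
    (h : walkPrefix ℓ a b c r i = walkPrefix ℓ a b c r' j) : r = r' ∧ i = j := by
  unfold walkPrefix at h
  rw [if_neg hi0, dif_pos hi] at h
  split_ifs at h with h1 h2
  · exact absurd h (hab _).1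
  · simpa using hc h
  · exact absurd h (hab _).2

/-- The pair of vertices used by the `j`-th step of a walk of the `r`-th family. -/
def walkEdge (ℓ : ℕ) (a b : Fin m → Fin 2) (c : Fin R × Fin ℓ → Fin m → Fin 2) {N : ℕ} (r : Fin R)
    (j : ℕ) (y z : Fin N → Fin 2) : Sym2 (KVertex (m + N)) :=
  s(Fin.append (walkPrefix ℓ a b c r j) y, Fin.append (walkPrefix ℓ a b c r (j + 1)) z)

theorem append_eq_append_iff {m N : ℕ} {X : Type*} {a a' : Fin m → X} {y y' : Fin N → X} :
    Fin.append a y = Fin.append a' y' ↔ a = a' ∧ y = y' := by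
  refine ⟨fun h => ⟨funext fun i => ?_, funext fun i => ?_⟩, by rintro ⟨rfl, rfl⟩; rfl⟩
  · simpa using congrFun h (Fin.castAdd N i)
  · simpa using congrFun h (Fin.natAdd m i)

/-- Each edge has an endpoint with an intermediate label, which identifies family and time. The
endpoints' prefixes `a` and `b` may coincide; then for `ℓ = 2` the first and last steps could be the
same edge reversed, hence `3 ≤ ℓ`. -/
theorem walkEdge_inj {c : Fin R × Fin ℓ → Fin m → Fin 2} (hc : Function.Injective c)
    (hab : ∀ p, c p ≠ a ∧ c p ≠ b) (hℓ : 3 ≤ ℓ) {N : ℕ} {r r' : Fin R} {i j : ℕ} (hi : i < ℓ)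
    (hj : j < ℓ) {y z y' z' : Fin N → Fin 2}
    (h : walkEdge ℓ a b c r i y z = walkEdge ℓ a b c r' j y' z') :
    r = r' ∧ i = j ∧ y = y' ∧ z = z' := by
  unfold walkEdge at h
  rw [Sym2.eq_iff, append_eq_append_iff, append_eq_append_iff, append_eq_append_iff,
    append_eq_append_iff] at h
  rcases h with ⟨⟨h1, hy⟩, h2, hz⟩ | ⟨⟨h1, -⟩, h2, -⟩
  · by_cases hi0 : i = 0
    · have := walkPrefix_inj hc hab (by omega) (by omega) h2
      exact ⟨this.1, by omega, hy, hz⟩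
    · have := walkPrefix_inj hc hab hi0 hi h1
      exact ⟨this.1, this.2, hy, hz⟩
  · exfalso
    by_cases hi0 : i = 0
    · have h3 := walkPrefix_inj hc hab (by omega) (by omega) h2
      have h4 := walkPrefix_inj hc hab (by omega) (by omega) h1.symm
      omega
    · have h3 := walkPrefix_inj hc hab hi0 hi h1
      by_cases hj0 : j = 0
      · have h4 := walkPrefix_inj hc hab (by omega) (by omega) h2
        omega
      · have h4 := walkPrefix_inj hc hab hj0 hj h2.symm
        omega

theorem exists_codes (h : R * ℓ + 2 ≤ 2 ^ m) (a b : Fin m → Fin 2) :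
    ∃ c : Fin R × Fin ℓ → Fin m → Fin 2, Function.Injective c ∧ ∀ p, c p ≠ a ∧ c p ≠ b := by
  obtain ⟨S, hS⟩ : ∃ S : Finset (Fin m → Fin 2), S = (Finset.univ.erase a).erase b := ⟨_, rfl⟩
  have hcard : Fintype.card (Fin R × Fin ℓ) ≤ Fintype.card S := by
    have h1 := Finset.pred_card_le_card_erase (s := Finset.univ.erase a) (a := b)
    have h2 := Finset.pred_card_le_card_erase (s := (Finset.univ : Finset (Fin m → Fin 2))) (a := a)
    simp only [Fintype.card_coe, Fintype.card_prod, Fintype.card_fin, Finset.card_univ,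
      Fintype.card_fun, hS] at h1 h2 ⊢
    omega
  obtain ⟨f⟩ := Function.Embedding.nonempty_of_card_le hcard
  refine ⟨fun p => f p, fun p p' hpp => f.injective (Subtype.ext hpp), fun p => ?_⟩
  have := (f p).2
  simp only [hS, Finset.mem_erase] at this
  exact ⟨this.2.1, this.1⟩

end Universes

/-- The `R` families use disjoint sets of edges, so their failures are independent, each of
probability at most `1 - 1 / (1 + 2 ^ ℓ)`. -/
theorem measureReal_lt_edist_le {α β γ : unitInterval} (hγ : 0 < (γ : ℝ)) (hβ : 0 < (β : ℝ))
    (hαγ : γ ≤ α) {σ : ℝ} {f : ℕ → ℝ} {ℓ : ℕ} (hσ : 1 < σ) (hf : ∀ k, 0 < f k)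
    (hρf : ∀ k, (1 + (|(γ : ℝ) - β| / (γ + β)) ^ k) / 2 ≤ σ * f k)
    (hff : ∀ i k, f i * f k ≤ f (i + k + 1)) (hℓ : 3 ≤ ℓ) (hfℓ : f ℓ = σ / 2)
    (hρℓ : 1 / (2 * σ) ≤ (1 - (|(γ : ℝ) - β| / (γ + β)) ^ ℓ) / 2) {m N R : ℕ}
    (hN : (σ ^ 4) ^ N ≤ (min (γ : ℝ) β) ^ m * (γ + β) ^ N) (hR : R * ℓ + 2 ≤ 2 ^ m)
    (u v : KVertex (m + N)) :
    (kroneckerMeasure (m + N) α β γ).real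
      {ω | (ℓ : ℕ∞) < (kroneckerGraph (m + N) ω).edist u v} ≤ (1 - 1 / (1 + 2 ^ ℓ)) ^ R := by
  obtain ⟨c, hc, hab⟩ := exists_codes hR (fun i => u (Fin.castAdd N i)) fun i => v (Fin.castAdd N i)
  set a := fun i => u (Fin.castAdd N i) with ha
  set b := fun i => v (Fin.castAdd N i) with hb
  set u' := fun i => u (Fin.natAdd m i) with hu'
  set v' := fun i => v (Fin.natAdd m i) with hv'
  have hu : Fin.append a u' = u := Fin.append_castAdd_natAdd
  have hv : Fin.append b v' = v := Fin.append_castAdd_natAdd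
  set κ := min (γ : ℝ) β with hκ
  have hκ0 : 0 < κ := lt_min hγ hβ
  have hαγ' : (γ : ℝ) ≤ α := hαγ
  have hini : ∀ x y, (!![(γ : ℝ), β; β, γ] : Matrix (Fin 2) (Fin 2) ℝ) x y ≤
      initiator α β γ x y := by
    intro x y; fin_cases x <;> fin_cases y <;> simp [initiator, hαγ']
  have hκe : ∀ x y, κ ≤ (!![(γ : ℝ), β; β, γ] : Matrix (Fin 2) (Fin 2) ℝ) x y := by
    intro x y; fin_cases x <;> fin_cases y <;> simp [hκ]
  have hq : ∀ (r : Fin R), ∀ j < ℓ, ∀ y z : Fin N → Fin 2,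
      κ ^ m * tensorPow !![(γ : ℝ), β; β, γ] (Fin N) y z ≤
      edgeProb (m + N) α β γ (walkEdge ℓ a b c r j y z) := by
    intro r j _ y z
    rw [walkEdge, edgeProb_mk, Fin.prod_univ_add]
    simp only [Fin.append_left, Fin.append_right, tensorPow, Matrix.of_apply]
    refine mul_le_mul ?_ ?_ ?_ ?_
    · have : κ ^ m = ∏ _i : Fin m, κ := by simp
      rw [this]
      exact Finset.prod_le_prod (fun _ _ => hκ0.le) fun _ _ => (hκe _ _).trans (hini _ _)
    · exact Finset.prod_le_prod (fun _ _ => hκ0.le.trans (hκe _ _)) fun _ _ => hini _ _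
    · exact Finset.prod_nonneg fun _ _ => hκ0.le.trans (hκe _ _)
    · exact Finset.prod_nonneg fun _ _ => unitInterval.nonneg _
  set A : Fin R → Set (Sym2 (KVertex (m + N)) → Bool) := fun r =>
    {ω | walkWeight (edgeProb (m + N) α β γ) (tensorPow !![(γ : ℝ), β; β, γ] (Fin N))
      (walkEdge ℓ a b c r) u' ℓ v' ω = 0} with hA
  have hsub : {ω | (ℓ : ℕ∞) < (kroneckerGraph (m + N) ω).edist u v} ⊆
      {ω | ∀ r ∈ Finset.univ, ω ∈ A r} := by
    intro ω hω r _
    by_contra hne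
    have := walkWeight_induction (ω := ω) _ _ _ u' (fun j z =>
      (kroneckerGraph (m + N) ω).edist u (Fin.append (walkPrefix ℓ a b c r j) z) ≤ j)
      (by simp [walkPrefix, hu]) (fun j y z hy hyz => ?_) ℓ v' hne
    · simp only [walkPrefix, lt_irrefl, dif_neg, not_false_eq_true] at this
      rw [if_neg (by omega), hv] at this
      exact absurd hω (not_lt.2 this)
    · refine (SimpleGraph.edist_triangle).trans ((add_le_add hy (edist_le_one_of_eq_true hyz)).trans ?_)
      simp
  refine (measureReal_mono (μ := bernoulliPi (edgeProb (m + N) α β γ)) hsub).trans ?_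
  have hpow := measureReal_iInter_le_pow (edgeProb (m + N) α β γ) Finset.univ A
    (fun r => walkCoords (walkEdge ℓ a b c r) ℓ) ?_ ?_ (c := 1 - 1 / (1 + 2 ^ ℓ)) ?_
  · simpa using hpow
  · intro r _ r' _ hr
    rw [Function.onFun, Set.disjoint_left]
    rintro _ ⟨i, hi, y, z, rfl⟩ ⟨j, hj, y', z', h⟩
    exact hr (walkEdge_inj hc hab hℓ hj hi h).1.symm
  · intro r _ x y hxy
    simp only [hA, Set.mem_ofPred_eq]
    rw [dependsOn_walkWeight _ _ _ _ _ _ hxy]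
  · intro r _
    have h1 := le_measureReal_tensorWalk (ι := Fin N) (e := walkEdge ℓ a b c r) hγ hβ hσ hf hρf hff
      hfℓ hρℓ (pow_pos hκ0 m) (by simpa using hN) (hq r)
      (fun i hi j hj y z y' z' h => (walkEdge_inj hc hab hℓ hi hj h).2) u' v'
    have h2 := probReal_compl_eq_one_sub (μ := bernoulliPi (edgeProb (m + N) α β γ))
      (s := A r) .of_discrete
    have h3 : (A r)ᶜ = {ω | walkWeight (edgeProb (m + N) α β γ)
      (tensorPow !![(γ : ℝ), β; β, γ] (Fin N)) (walkEdge ℓ a b c r) u' ℓ v' ω ≠ 0} := rfl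
    rw [h3] at h2
    linarith

theorem tendsto_nat_sqrt_atTop : Tendsto Nat.sqrt atTop atTop :=
  tendsto_atTop.2 fun k => (eventually_ge_atTop (k * k)).mono fun _ hn => Nat.le_sqrt.2 hn

theorem eventually_mul_add_le_two_pow_sqrt (A B : ℕ) :
    ∀ᶠ n : ℕ in atTop, A * n + B ≤ 2 ^ n.sqrt := by
  have h : ∀ᶠ k : ℕ in atTop, A * (k + 1) ^ 2 + B ≤ 2 ^ k := by
    have h0 := (tendsto_pow_const_div_const_pow_of_one_lt 2 (one_lt_two : (1 : ℝ) < 2))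
      |>.eventually_le_const (u := (1 : ℝ) / (4 * (A : ℝ) + (B : ℝ) + 1)) (by positivity)
    filter_upwards [h0, eventually_ge_atTop 1] with k hk hk1
    rw [div_le_div_iff₀ (by positivity) (by positivity), one_mul] at hk
    have hk1' : (1 : ℝ) ≤ k := by exact_mod_cast hk1
    have : (A * (k + 1) ^ 2 + B : ℝ) ≤ 2 ^ k := by
      refine le_trans ?_ hk
      have hA : (0 : ℝ) ≤ A := Nat.cast_nonneg _
      have hB : (0 : ℝ) ≤ B := Nat.cast_nonneg _
      have h1 : ((k : ℝ) + 1) ^ 2 ≤ 4 * k ^ 2 := by nlinarith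
      have h2 : (1 : ℝ) ≤ k ^ 2 := one_le_pow₀ hk1'
      nlinarith [mul_le_mul_of_nonneg_left h1 hA, mul_le_mul_of_nonneg_left h2 hB]
    exact_mod_cast this
  filter_upwards [tendsto_nat_sqrt_atTop.eventually h] with n hn
  refine le_trans ?_ hn
  have := n.lt_succ_sqrt
  gcongr
  rw [sq]
  exact this.le

/-- Labels of length `√n` cost `κ ^ √n`, which is negligible against `(y / x) ^ (n - √n)`. -/
theorem eventually_pow_sub_sqrt_le {x y κ : ℝ} (hx : 0 < x) (hxy : x < y) (hκ : 0 < κ) :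
    ∀ᶠ n : ℕ in atTop, x ^ (n - n.sqrt) ≤ κ ^ n.sqrt * y ^ (n - n.sqrt) := by
  obtain ⟨L, hL⟩ := pow_unbounded_of_one_lt κ⁻¹ ((one_lt_div hx).2 hxy)
  filter_upwards [tendsto_nat_sqrt_atTop.eventually (eventually_ge_atTop (L + 1))] with n hn
  have h1 : L * n.sqrt ≤ n - n.sqrt := by
    have h2 := n.sqrt_le
    have h3 := Nat.mul_le_mul_right n.sqrt hn
    rw [add_mul, one_mul] at h3
    omega
  have h4 : 1 ≤ κ ^ n.sqrt * (y / x) ^ (n - n.sqrt) := by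
    calc 1 ≤ (κ * (y / x) ^ L) ^ n.sqrt := one_le_pow₀ (by
            rw [inv_lt_iff_one_lt_mul₀ hκ] at hL
            linarith)
      _ = κ ^ n.sqrt * (y / x) ^ (L * n.sqrt) := by rw [mul_pow, pow_mul]
      _ ≤ _ := by
        gcongr
        exact ((one_lt_div hx).2 hxy).le
  rw [div_pow, ← mul_div_assoc, one_le_div (by positivity)] at h4
  exact h4

theorem exists_tendsto_of_one_lt {α β γ : unitInterval} (hαγ : γ ≤ α)
    (h : 1 < (β : ℝ) + (γ : ℝ)) :
    ∃ a : ℕ, Tendsto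
      (fun n : ℕ => kroneckerMeasure n α β γ {ω | (kroneckerGraph n ω).ediam ≤ (a : ℕ∞)})
      atTop (𝓝 1) := by
  have hβ1 := unitInterval.le_one β
  have hγ1 := unitInterval.le_one γ
  have hβ : 0 < (β : ℝ) := by linarith
  have hγ : 0 < (γ : ℝ) := by linarith
  have hρ1 : |(γ : ℝ) - β| / (γ + β) < 1 := by
    rw [div_lt_one (by positivity), abs_lt]
    constructor <;> linarith
  obtain ⟨σ, hσ, hσs, f, hf, hρf, hff, ℓ, hℓ, hfℓ, hρℓ⟩ := exists_growth_constants
    (s := (γ : ℝ) + β) (by linarith) (by linarith) (by positivity) hρ1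
  set p : ℝ := 1 - 1 / (1 + 2 ^ ℓ) with hp
  have hp1 : p < 1 := by
    have : (0 : ℝ) < 1 / (1 + 2 ^ ℓ) := by positivity
    linarith
  have hp0 : 0 ≤ p := by
    have : (1 : ℝ) / (1 + 2 ^ ℓ) ≤ 1 := div_le_one_of_le₀ (by
      have : (0 : ℝ) < 2 ^ ℓ := by positivity
      linarith) (by positivity)
    linarith
  -- With `C * n` families, failure has probability at most `(p ^ C) ^ n`; any bound on `p ^ C`
  -- below `1 / 4` would beat the number of pairs.
  obtain ⟨C, hC⟩ := exists_pow_lt_of_lt_one (by norm_num : (0 : ℝ) < 1 / 8) hp1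
  refine ⟨ℓ, tendsto_measure_ediam_le (ε := fun n => (p ^ C) ^ n) ?_ ?_⟩
  · simp only [← mul_pow]
    have : 0 ≤ p ^ C := by positivity
    exact tendsto_pow_atTop_nhds_zero_of_lt_one (by positivity) (by linarith)
  · have hcodes : ∀ᶠ n : ℕ in atTop, C * n * ℓ + 2 ≤ 2 ^ n.sqrt := by
      filter_upwards [eventually_mul_add_le_two_pow_sqrt (C * ℓ) 2] with n hn
      rwa [mul_right_comm]
    have hbase : ∀ᶠ n : ℕ in atTop, (σ ^ 4) ^ (n - n.sqrt) ≤
        (min (γ : ℝ) β) ^ n.sqrt * (γ + β) ^ (n - n.sqrt) :=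
      eventually_pow_sub_sqrt_le (pow_pos (by linarith) 4) hσs (lt_min hγ hβ)
    filter_upwards [hcodes, hbase] with n h1 h2 u v
    obtain ⟨N, hN⟩ : ∃ N, n = n.sqrt + N := ⟨n - n.sqrt, by have := n.sqrt_le_self; omega⟩
    obtain ⟨m, hm⟩ : ∃ m, m = n.sqrt := ⟨_, rfl⟩
    rw [← hm] at hN h1 h2
    clear hm
    subst hN
    rw [Nat.add_sub_cancel_left] at h2
    rw [← pow_mul]
    exact measureReal_lt_edist_le hγ hβ hαγ hσ hf hρf hff hℓ hfℓ hρℓ h2 h1 u v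

/-! ### The case `β = 1`, `γ = 0`: climbing through subsets. -/

/-- The vertex whose set of ones is `S`. -/
def indVertex {n : ℕ} (S : Finset (Fin n)) : KVertex n := fun i => if i ∈ S then 1 else 0

theorem indVertex_injective {n : ℕ} : Function.Injective (indVertex (n := n)) := by
  intro S T h
  ext i
  have := congrFun h i
  simp only [indVertex] at this
  split_ifs at this <;> simp_all

theorem indVertex_filter {n : ℕ} (u : KVertex n) :
    indVertex (Finset.univ.filter fun i => u i = 1) = u := by
  ext i
  simp only [indVertex, Finset.mem_filter, Finset.mem_univ, true_and]
  split_ifs <;> omega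

theorem edgeProb_indVertex {n : ℕ} (α : unitInterval) {S T : Finset (Fin n)}
    (hST : S ∪ T = Finset.univ) :
    (edgeProb n α 1 0 s(indVertex S, indVertex T) : ℝ) = (α : ℝ) ^ (S ∩ T).card := by
  rw [edgeProb_mk, ← Finset.prod_const, ← Finset.prod_filter_mul_prod_filter_not _ (· ∈ S ∩ T)]
  rw [Finset.prod_eq_one (s := Finset.univ.filter fun i => ¬ i ∈ S ∩ T), mul_one]
  · refine Finset.prod_congr (by ext; simp) fun i hi => ?_
    have hi' := Finset.mem_inter.1 hi
    simp [indVertex, hi'.1, hi'.2, initiator]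
  · intro i hi
    have h1 := (Finset.mem_filter.1 hi).2
    have h2 : i ∈ S ∪ T := hST ▸ Finset.mem_univ i
    rw [Finset.mem_inter] at h1
    rw [Finset.mem_union] at h2
    by_cases h : i ∈ S
    · have h3 : i ∉ T := fun h' => h1 ⟨h, h'⟩
      simp [indVertex, h, h3, initiator]
    · have h3 : i ∈ T := h2.resolve_left h
      simp [indVertex, h, h3, initiator]

/-- Combine `(z + 1 - k) ^ k / k! ≤ z.choose k` with `k! ≤ k ^ k`. -/
theorem pow_le_choose_of_mul_le {M k z : ℕ} (h : (M + 1) * k ≤ z) : M ^ k ≤ z.choose k := by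
  have h1 := Nat.pow_le_choose (α := ℝ) k z
  have h2 : (M : ℝ) ^ k ≤ ((z + 1 - k : ℕ) ^ k : ℝ) / (k.factorial : ℝ) := by
    rw [le_div_iff₀ (by positivity)]
    have h3 : M ^ k * k.factorial ≤ (z + 1 - k) ^ k := by
      calc M ^ k * k.factorial ≤ M ^ k * k ^ k := by
            gcongr
            exact Nat.factorial_le_pow k
        _ = (M * k) ^ k := (mul_pow _ _ _).symm
        _ ≤ _ := by
          gcongr
          rw [add_mul, one_mul] at h
          omega
    exact_mod_cast h3
  exact_mod_cast h2.trans h1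

section Climb

variable {n k L M : ℕ} {α : unitInterval}

theorem measureReal_compl_edge_false (S : Finset (Fin n)) :
    (bernoulliPi (edgeProb n α 1 0)).real {ω | ¬ ω s(indVertex S, indVertex Sᶜ) = true} = 0 := by
  have h := probReal_compl_eq_one_sub (μ := bernoulliPi (edgeProb n α 1 0))
    (s := {ω | ω s(indVertex S, indVertex Sᶜ) = true}) .of_discrete
  rw [measureReal_coord_true, edgeProb_indVertex α (Finset.union_compl S), Finset.inter_compl,
    Finset.card_empty, pow_zero, sub_self] at h
  exact h

/-- The at least `L ^ k` candidate edges are distinct and each open with probability `α ^ k`, so the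
expected number of open ones is at least `(α * L) ^ k ≥ 2 ^ k`. -/
theorem measureReal_no_upper_edge_le (hL : 2 ≤ (α : ℝ) * L) (S : Finset (Fin n))
    (hS : (L + 1) * k ≤ Sᶜ.card) :
    (bernoulliPi (edgeProb n α 1 0)).real
      {ω | ∀ A ∈ Sᶜ.powersetCard k, ¬ ω s(indVertex (S ∪ A), indVertex Sᶜ) = true} ≤
      Real.exp (-2 ^ k) := by
  have hα : 0 ≤ (α : ℝ) := unitInterval.nonneg α
  have h := measureReal_forall_exists_false_le (edgeProb n α 1 0) (Sᶜ.powersetCard k)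
    (fun A => {s(indVertex (S ∪ A), indVertex Sᶜ)}) (c := (α : ℝ) ^ k) ?_ ?_
  · simp only [Finset.mem_singleton, forall_eq] at h
    refine h.trans (Real.exp_le_exp.2 (neg_le_neg ?_))
    rw [Finset.card_powersetCard]
    have h1 : (L : ℝ) ^ k ≤ (Sᶜ.card.choose k : ℝ) := by exact_mod_cast pow_le_choose_of_mul_le hS
    calc (2 : ℝ) ^ k ≤ (α * L) ^ k := by gcongr
      _ = (α : ℝ) ^ k * (L : ℝ) ^ k := mul_pow _ _ _
      _ ≤ _ := by gcongr
  · intro A hA B hB hAB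
    rw [Function.onFun, Finset.disjoint_singleton]
    intro h
    rw [Sym2.congr_left] at h
    have h1 := indVertex_injective h
    have hA' := (Finset.mem_powersetCard.1 hA).1
    have hB' := (Finset.mem_powersetCard.1 hB).1
    refine hAB ?_
    have e : ∀ C ⊆ Sᶜ, (S ∪ C) \ S = C := fun C hC => by
      rw [Finset.union_sdiff_left, Finset.sdiff_eq_self_iff_disjoint]
      exact Finset.disjoint_left.2 fun i hi hi' => Finset.mem_compl.1 (hC hi) hi'
    rw [← e A hA', ← e B hB', h1]
  · intro A hA
    obtain ⟨hA1, hA2⟩ := Finset.mem_powersetCard.1 hA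
    rw [Finset.prod_singleton, edgeProb_indVertex]
    · have : (S ∪ A) ∩ Sᶜ = A := by
        rw [Finset.union_inter_distrib_right, Finset.inter_compl, Finset.empty_union,
          Finset.inter_eq_left.2 hA1]
      rw [this, hA2]
    · rw [Finset.union_right_comm, Finset.union_compl]
      simp

/-- The two edges through `Sᶜ ∪ A` have intersections of sizes `k` and at most `(L + 1) * k`, so
both are open with probability at least `α ^ ((L + 2) * k)`; the at least `M ^ k` choices of `A`
compensate. -/
theorem measureReal_no_two_step_le (hM : 2 ≤ (α : ℝ) ^ (L + 2) * M) (S : Finset (Fin n))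
    (hS1 : S ≠ Finset.univ) (hS : Sᶜ.card ≤ L * k) (hn : (L + M + 1) * k ≤ n) :
    (bernoulliPi (edgeProb n α 1 0)).real
      {ω | ∀ A ∈ S.powersetCard k, ¬ (ω s(indVertex S, indVertex (Sᶜ ∪ A)) = true ∧
        ω s(indVertex (Sᶜ ∪ A), indVertex Finset.univ) = true)} ≤
      Real.exp (-2 ^ k) := by
  have hα : 0 ≤ (α : ℝ) := unitInterval.nonneg α
  have hα1 : (α : ℝ) ≤ 1 := unitInterval.le_one α
  have h := measureReal_forall_exists_false_le (edgeProb n α 1 0) (S.powersetCard k)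
    (fun A => {s(indVertex S, indVertex (Sᶜ ∪ A)),
      s(indVertex (Sᶜ ∪ A), indVertex Finset.univ)}) (c := ((α : ℝ) ^ (L + 2)) ^ k) ?_ ?_
  · simp only [Finset.mem_insert, Finset.mem_singleton, forall_eq_or_imp, forall_eq] at h
    refine h.trans (Real.exp_le_exp.2 (neg_le_neg ?_))
    rw [Finset.card_powersetCard]
    have h0 : (M + 1) * k ≤ S.card := by
      have := Finset.card_add_card_compl S
      rw [Fintype.card_fin] at this
      have e : (L + M + 1) * k = L * k + (M + 1) * k := by ring
      omega
    have h1 : (M : ℝ) ^ k ≤ (S.card.choose k : ℝ) := by exact_mod_cast pow_le_choose_of_mul_le h0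
    calc (2 : ℝ) ^ k ≤ (α ^ (L + 2) * M) ^ k := by gcongr
      _ = ((α : ℝ) ^ (L + 2)) ^ k * (M : ℝ) ^ k := mul_pow _ _ _
      _ ≤ _ := by gcongr
  · intro A hA B hB hAB
    have hA' := (Finset.mem_powersetCard.1 hA).1
    have hB' := (Finset.mem_powersetCard.1 hB).1
    have e : ∀ C ⊆ S, (Sᶜ ∪ C) ∩ S = C := fun C hC => by
      rw [Finset.union_inter_distrib_right, Finset.inter_comm, Finset.inter_compl,
        Finset.empty_union, Finset.inter_eq_left.2 hC]
    have hX : indVertex (Sᶜ ∪ A) ≠ indVertex (Sᶜ ∪ B) := fun h => hAB (by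
      rw [← e A hA', ← e B hB', indVertex_injective h])
    have hSU : indVertex S ≠ indVertex Finset.univ := fun h => hS1 (indVertex_injective h)
    have hSX : ∀ C, indVertex (Sᶜ ∪ C) ≠ indVertex S := fun C h => by
      have h1 := indVertex_injective h
      refine hS1 (Finset.eq_univ_iff_forall.2 fun i => ?_)
      by_contra hi
      have : i ∈ Sᶜ ∪ C := Finset.mem_union_left _ (Finset.mem_compl.2 hi)
      exact hi (h1 ▸ this)
    -- The middle vertex determines `A` and differs from `S`, so different `A` share no edge.
    rw [Function.onFun, Finset.disjoint_left]
    intro x hx hx'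
    simp only [Finset.mem_insert, Finset.mem_singleton] at hx hx'
    rcases hx with rfl | rfl <;> rcases hx' with h | h <;> rw [Sym2.eq_iff] at h
    · rcases h with ⟨-, h⟩ | ⟨h, -⟩
      · exact hX h
      · exact hSX B h.symm
    · rcases h with ⟨h, -⟩ | ⟨h, -⟩
      · exact hSX B h.symm
      · exact hSU h
    · rcases h with ⟨h, -⟩ | ⟨-, h⟩
      · exact hSX A h
      · exact hSU h.symm
    · rcases h with ⟨h, -⟩ | ⟨h, h'⟩
      · exact hX h
      · exact hX (h.trans h')
  · intro A hA
    obtain ⟨hA1, hA2⟩ := Finset.mem_powersetCard.1 hA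
    have hSU : indVertex S ≠ indVertex Finset.univ := fun h => hS1 (indVertex_injective h)
    rw [Finset.prod_pair, edgeProb_indVertex,
      edgeProb_indVertex (S := Sᶜ ∪ A) (T := Finset.univ) α
        (Finset.eq_univ_iff_forall.2 fun i => by simp)]
    · have h1 : S ∩ (Sᶜ ∪ A) = A := by
        rw [Finset.inter_union_distrib_left, Finset.inter_compl, Finset.empty_union,
          Finset.inter_eq_right.2 hA1]
      rw [h1, hA2, Finset.inter_univ, ← pow_add, ← pow_mul]
      refine pow_le_pow_of_le_one hα hα1 ?_
      have := Finset.card_union_le Sᶜ A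
      have e : (L + 2) * k = L * k + k + k := by ring
      omega
    · rw [← Finset.union_assoc, Finset.union_compl]
      simp
    · intro h
      rw [Sym2.eq_iff] at h
      rcases h with ⟨h, h'⟩ | ⟨h, -⟩
      · exact hSU (h.trans h')
      · exact hSU h

/-- Each climb `S`, `Sᶜ`, `S ∪ A` takes two steps and removes `k` zeros; the final `2` is the
connection to the full set. -/
theorem edist_indVertex_univ_le {ω : Sym2 (KVertex n) → Bool}
    (h1 : ∀ S : Finset (Fin n), ω s(indVertex S, indVertex Sᶜ) = true)
    (h2 : ∀ S : Finset (Fin n), (L + 1) * k ≤ Sᶜ.card →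
      ∃ A ∈ Sᶜ.powersetCard k, ω s(indVertex (S ∪ A), indVertex Sᶜ) = true)
    (h3 : ∀ S : Finset (Fin n), S ≠ Finset.univ → Sᶜ.card ≤ (L + 1) * k →
      ∃ A ∈ S.powersetCard k, ω s(indVertex S, indVertex (Sᶜ ∪ A)) = true ∧
        ω s(indVertex (Sᶜ ∪ A), indVertex Finset.univ) = true)
    (t : ℕ) (S : Finset (Fin n)) (hS : Sᶜ.card ≤ (L + 1) * k + t * k) :
    (kroneckerGraph n ω).edist (indVertex S) (indVertex Finset.univ) ≤ (2 * t + 2 : ℕ) := by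
  induction t generalizing S with
  | zero =>
    by_cases hU : S = Finset.univ
    · simp [hU]
    · obtain ⟨A, -, hA1, hA2⟩ := h3 S hU (by simpa using hS)
      refine SimpleGraph.edist_triangle.trans ((add_le_add (edist_le_one_of_eq_true hA1)
        (edist_le_one_of_eq_true hA2)).trans ?_)
      norm_num
  | succ t ih =>
    by_cases hle : Sᶜ.card ≤ (L + 1) * k + t * k
    · refine (ih S hle).trans ?_
      exact_mod_cast (by omega : 2 * t + 2 ≤ 2 * (t + 1) + 2)
    · have hge : (L + 1) * k ≤ Sᶜ.card := by
        have := Nat.zero_le (t * k)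
        omega
      obtain ⟨A, hA, hAe⟩ := h2 S hge
      obtain ⟨hA1, hA2⟩ := Finset.mem_powersetCard.1 hA
      have hcard : (S ∪ A)ᶜ.card ≤ (L + 1) * k + t * k := by
        have e : (S ∪ A)ᶜ = Sᶜ \ A := by
          ext i; simp
        rw [e, Finset.card_sdiff_of_subset hA1, hA2]
        have e' : (t + 1) * k = t * k + k := by ring
        omega
      rw [Sym2.eq_swap] at hAe
      refine SimpleGraph.edist_triangle.trans ((add_le_add (edist_le_one_of_eq_true (h1 S))
        (SimpleGraph.edist_triangle.trans (add_le_add (edist_le_one_of_eq_true hAe)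
          (ih _ hcard)))).trans ?_)
      exact_mod_cast (by omega : 1 + (1 + (2 * t + 2)) ≤ 2 * (t + 1) + 2)

theorem measureReal_lt_edist_le_exp (hL : 2 ≤ (α : ℝ) * L) (hM : 2 ≤ (α : ℝ) ^ (L + 1 + 2) * M)
    (hn : (L + 1 + M + 1) * k ≤ n) {t : ℕ} (ht : n ≤ (L + 1) * k + t * k) (u v : KVertex n) :
    (kroneckerMeasure n α 1 0).real
      {ω | ((2 * (2 * t + 2) : ℕ) : ℕ∞) < (kroneckerGraph n ω).edist u v} ≤
      2 ^ n * (2 * Real.exp (-2 ^ k)) := by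
  -- The bad events do not involve `u` and `v`: off their union every vertex is near the full set.
  set B : Finset (Fin n) → Set (Sym2 (KVertex n) → Bool) := fun S =>
    {ω | ¬ ω s(indVertex S, indVertex Sᶜ) = true} ∪
    ({ω | (L + 1) * k ≤ Sᶜ.card ∧
      ∀ A ∈ Sᶜ.powersetCard k, ¬ ω s(indVertex (S ∪ A), indVertex Sᶜ) = true} ∪
    {ω | (S ≠ Finset.univ ∧ Sᶜ.card ≤ (L + 1) * k) ∧
      ∀ A ∈ S.powersetCard k, ¬ (ω s(indVertex S, indVertex (Sᶜ ∪ A)) = true ∧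
        ω s(indVertex (Sᶜ ∪ A), indVertex Finset.univ) = true)}) with hB
  have hsub : {ω | ((2 * (2 * t + 2) : ℕ) : ℕ∞) < (kroneckerGraph n ω).edist u v} ⊆
      ⋃ S, B S := by
    intro ω hω
    by_contra hne
    simp only [hB, Set.mem_iUnion, Set.mem_union, Set.mem_ofPred_eq, not_exists, not_or,
      not_and, not_forall, not_not, exists_prop] at hne
    have key := edist_indVertex_univ_le (L := L) (k := k) (fun S => (hne S).1)
      (fun S hS => (hne S).2.1 hS) (fun S hS hS' => (hne S).2.2 ⟨hS, hS'⟩) t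
    have hall : ∀ w : KVertex n,
        (kroneckerGraph n ω).edist w (indVertex Finset.univ) ≤ (2 * t + 2 : ℕ) := fun w => by
      rw [← indVertex_filter w]
      refine key _ ((Finset.card_le_univ _).trans ?_)
      simpa using ht
    suffices hle : (kroneckerGraph n ω).edist u v ≤ ((2 * (2 * t + 2) : ℕ) : ℕ∞) from
      absurd hω (not_lt.2 hle)
    refine (SimpleGraph.edist_triangle (v := indVertex Finset.univ)).trans ?_
    rw [SimpleGraph.edist_comm (u := indVertex Finset.univ)]
    refine (add_le_add (hall u) (hall v)).trans ?_
    exact_mod_cast (by omega : 2 * t + 2 + (2 * t + 2) ≤ 2 * (2 * t + 2))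
  have hcond : ∀ (c : Prop) (X : Set (Sym2 (KVertex n) → Bool)) {x : ℝ}, 0 ≤ x →
      (c → (bernoulliPi (edgeProb n α 1 0)).real X ≤ x) →
      (bernoulliPi (edgeProb n α 1 0)).real {ω | c ∧ ω ∈ X} ≤ x := by
    intro c X x hx h
    by_cases hc : c
    · simpa [hc] using h hc
    · simpa [hc] using hx
  have hbound : ∀ S, (bernoulliPi (edgeProb n α 1 0)).real (B S) ≤ 2 * Real.exp (-2 ^ k) := by
    intro S
    refine (measureReal_union_le _ _).trans ?_
    rw [measureReal_compl_edge_false, zero_add, two_mul]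
    refine (measureReal_union_le _ _).trans (add_le_add ?_ ?_)
    · exact hcond _ {ω | ∀ A ∈ Sᶜ.powersetCard k,
        ¬ ω s(indVertex (S ∪ A), indVertex Sᶜ) = true} (Real.exp_pos _).le
        fun h => measureReal_no_upper_edge_le hL S h
    · exact hcond _ {ω | ∀ A ∈ S.powersetCard k,
        ¬ (ω s(indVertex S, indVertex (Sᶜ ∪ A)) = true ∧
        ω s(indVertex (Sᶜ ∪ A), indVertex Finset.univ) = true)} (Real.exp_pos _).le
        fun h => measureReal_no_two_step_le hM S h.1 h.2 hn
  refine (measureReal_mono (μ := bernoulliPi (edgeProb n α 1 0)) hsub).trans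
    ((measureReal_iUnion_fintype_le _).trans ((Finset.sum_le_sum fun S _ => hbound S).trans_eq ?_))
  rw [Finset.sum_const, Finset.card_univ, Fintype.card_finset, Fintype.card_fin, nsmul_eq_mul]
  push_cast
  rfl

end Climb

theorem exists_tendsto_of_eq_one_of_eq_zero {α : unitInterval} (hα : 0 < (α : ℝ)) :
    ∃ a : ℕ, Tendsto
      (fun n : ℕ => kroneckerMeasure n α 1 0 {ω | (kroneckerGraph n ω).ediam ≤ (a : ℕ∞)})
      atTop (𝓝 1) := by
  obtain ⟨L, hL⟩ := exists_nat_ge (2 / (α : ℝ))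
  obtain ⟨M, hM⟩ := exists_nat_ge (2 / (α : ℝ) ^ (L + 1 + 2))
  rw [div_le_iff₀' (by positivity)] at hL hM
  obtain ⟨T, hT⟩ : ∃ T, T = L + 1 + M + 1 := ⟨_, rfl⟩
  -- With `k = n / T ≥ 1`, one has `n < T * (k + 1) ≤ 2 * T * k`, so `2 * T` climbs suffice; the
  -- outer factor `2` joins two vertices through the full set.
  refine ⟨2 * (2 * (2 * T) + 2), tendsto_measure_ediam_le
    (ε := fun n => 2 ^ n * (2 * Real.exp (-2 ^ (n / T)))) ?_ ?_⟩
  · have hlim : Tendsto (fun n : ℕ => 2 * (8 * Real.exp (-3)) ^ n) atTop (𝓝 0) := by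
      have h8 : 8 * Real.exp (-3) < 1 := by
        rw [Real.exp_neg, ← div_eq_mul_inv, div_lt_one (Real.exp_pos _)]
        have h1 : Real.exp 3 = Real.exp 1 ^ 3 := by rw [← Real.exp_nat_mul]; norm_num
        have h2 : (2 : ℝ) < Real.exp 1 := by linarith [Real.exp_one_gt_d9]
        rw [h1]
        calc (8 : ℝ) = 2 ^ 3 := by norm_num
          _ < _ := by gcongr
      simpa using (tendsto_pow_atTop_nhds_zero_of_lt_one (by positivity) h8).const_mul 2
    refine squeeze_zero' (Eventually.of_forall fun n => by positivity) ?_ hlim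
    filter_upwards [eventually_mul_add_le_two_pow_sqrt 3 0, eventually_ge_atTop (T * T)]
      with n h1 h2
    -- The crude bound `2 ^ √n ≥ 3 * n` already makes the failure probability at most a multiple of
    -- `exp (-3) ^ n`, and `8 * exp (-3) < 1`.
    have h3 : n.sqrt ≤ n / T := by
      rw [Nat.le_div_iff_mul_le (by omega)]
      exact (Nat.mul_le_mul_left _ (Nat.le_sqrt.2 h2)).trans n.sqrt_le
    have h4 : (3 * n : ℝ) ≤ 2 ^ (n / T) := by
      have := h1.trans (Nat.pow_le_pow_right two_pos h3)
      exact_mod_cast this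
    have h5 : Real.exp (-2 ^ (n / T)) ≤ Real.exp (-3) ^ n := by
      rw [← Real.exp_nat_mul]
      exact Real.exp_le_exp.2 (by linarith)
    calc (4 : ℝ) ^ n * (2 ^ n * (2 * Real.exp (-2 ^ (n / T))))
        ≤ 4 ^ n * (2 ^ n * (2 * Real.exp (-3) ^ n)) := by gcongr
      _ = 2 * ((4 * 2) * Real.exp (-3)) ^ n := by rw [mul_pow, mul_pow]; ring
      _ = _ := by norm_num
  · filter_upwards [eventually_ge_atTop T] with n hn u v
    have h1 : T * (n / T) ≤ n := Nat.mul_div_le n T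
    have h2 : 1 ≤ n / T := (Nat.one_le_div_iff (by omega)).2 hn
    have h3 : n < T * (n / T + 1) := Nat.lt_mul_div_succ n (by omega)
    refine measureReal_lt_edist_le_exp hL hM (hT ▸ h1) ?_ u v
    nlinarith [Nat.zero_le ((L + 1) * (n / T))]

theorem theorem2 (α β γ : unitInterval) (hαγ : γ ≤ α)
    (h : 1 < (β : ℝ) + (γ : ℝ) ∨ (β = 1 ∧ 0 < α ∧ γ = 0)) :
    ∃ a : ℕ, Tendsto
      (fun n : ℕ => kroneckerMeasure n α β γ {ω | (kroneckerGraph n ω).ediam ≤ (a : ℕ∞)})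
      atTop (𝓝 1) := by
  rcases h with h | ⟨rfl, hα, rfl⟩
  · exact exists_tendsto_of_one_lt hαγ h
  · exact exists_tendsto_of_eq_one_of_eq_zero hα
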